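/- **Model.** Let $V$ be a set of $n$ elements. A (valid) partition is a map $p:V\to\{0,1\}$ with $|p^{-1}(0)|=|p^{-1}(1)|=n/2$, and $\mathrm{dist}(p,p')=|\{v: p(v)\ne p'(v)\}|$. For a partition $\mathcal C$ of the set $V$ into components, let $\mathcal P(\mathcal C)$ be the set of valid partitions that are constant on every component of $\mathcal C$. An *epoch* $\mathcal E$ consists of an initial valid partition $p_0$ and a finite sequence of requests $(u_1,v_1),\dots,(u_N,v_N)$, fixed in advance (independently of the algorithm's random choices). Let $\mathcal C_0$ consist of the $n$ singletons. For each $t\ge 1$, $\mathcal P(\mathcal C_{t-1})\neq\emptyset$, the elements $u_t,v_t$ lie in distinct components of $\mathcal C_{t-1}$, and $\mathcal C_t$ arises from $\mathcal C_{t-1}$ by merging these two components. In step $t$ an algorithm pays $1$ if $p_{t-1}(u_t)\ne p_{t-1}(v_t)$ (and $0$ otherwise), then chooses a partition $p_t$ and pays $\mathrm{dist}(p_{t-1},p_t)$. **The algorithm ICB.** Let $q=\lceil n^{1/7}\rceil$, $w=4q^4+2$, $d=\lceil n^{13/14}/\sqrt{\log n}\rceil$. For $g\in\{1,2,\dots\}\cup\{\infty\}$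 let $R(g)=\{\ell g:\ell\in\mathbb N\}\cap\{1,\dots,q\}$ (so $R(\infty)=\emptyset$), and put $\gcd(\emptyset)=\infty$. Let $\mathcal P^g_\ell(\mathcal C)$ be the set of $p\in\mathcal P(\mathcal C)$ such that each of the two clusters contains at least $\ell$ components of $\mathcal C$ whose sizes lie in $R(g)$. Put $g_0=1$ and start in the first stage. In step $t$, if $\mathcal P(\mathcal C_t)=\emptyset$, then $p_t=p_{t-1}$ and the epoch ends. Otherwise: * *First stage.* Let $p_t^*$ be an element of $\mathcal P(\mathcal C_t)$ closest to $p_{t-1}$, let $B_t$ be the set of $i\in\{1,\dots,q\}$ such that $\mathcal C_t$ has at least $w$ components of size $i$, and let $g_t=\gcd(R(g_{t-1})\cap B_t)$. If $\mathcal P^{g_t}_{2d}(\mathcal C_t)=\emptyset$, then $p_t=p_{t-1}$ and the second stage begins with step $t+1$. Otherwise, $p_t=p_t^*$ if $p_t^*\in\mathcal P^{g_t}_d(\mathcal C_t)$, and $p_t$ is an arbitrary element of $\mathcal P^{g_t}_{2d}(\mathcal C_t)$ if not. * *Second stage.* If $p_{t-1}\in\mathcal P(\mathcal C_t)$, then $p_t=p_{t-1}$;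 otherwise $p_t$ is chosen uniformly at random from $\mathcal P(\mathcal C_t)$, independently of previous choices. **Lemma.** There are absolute constants $K$ and $n_0$ such that for all $n\ge n_0$, every set $V$ of $n$ elements, every epoch $\mathcal E$ on $V$, and every way of resolving the arbitrary choices of the first stage (ties for $p_t^*$ and the element of $\mathcal P^{g_t}_{2d}(\mathcal C_t)$), the expected total cost of ICB in $\mathcal E$ satisfies $$\mathbb E[\mathrm{ICB}(\mathcal E)]\le K\cdot n^{27/14}\cdot\sqrt{\log n}.$$ -/

import Mathlib

open scoped ENNReal

noncomputable section

namespace Bisection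

section Components

variable {V : Type*} [Fintype V] [DecidableEq V]

/-- A valid partition of `V` into the two clusters `false` (left) and `true` (right):
each cluster contains exactly half of the elements. -/
def IsBalanced (p : V → Bool) : Prop :=
  ∀ y : Bool, 2 * (Finset.univ.filter (fun v => p v = y)).card = Fintype.card V

instance (p : V → Bool) : Decidable (IsBalanced p) := by
  unfold IsBalanced; infer_instance

/-- The component of the component set `C` that contains `v`. -/
def componentOf (C : Finset (Finset V)) (v : V) : Finset V :=
  (C.filter (fun c => v ∈ c)).biUnion id

/-- Merge the components of `u` and `v`: remove both from `C` and add their union. -/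
def merge (C : Finset (Finset V)) (r : V × V) : Finset (Finset V) :=
  insert (componentOf C r.1 ∪ componentOf C r.2)
    (C \ {componentOf C r.1, componentOf C r.2})

/-- The component set after the requests `rs` of an epoch, starting from singletons. -/
def components (rs : List (V × V)) : Finset (Finset V) :=
  rs.foldl merge (Finset.univ.image (fun v => {v}))

/-- The set of all valid partitions that keep every component of `C` in one cluster. -/
def preserving (C : Finset (Finset V)) : Finset (V → Bool) :=
  Finset.univ.filter (fun p => IsBalanced p ∧ ∀ c ∈ C, ∀ u ∈ c, ∀ v ∈ c, p u = p v)

/-- The input of a single epoch (finished or not): every request joins two distinct current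
components, and no request is issued once no component-preserving partition exists. -/
def IsEpoch (rs : List (V × V)) : Prop :=
  ∀ (t : ℕ) (ht : t < rs.length),
    componentOf (components (rs.take t)) rs[t].1 ≠ componentOf (components (rs.take t)) rs[t].2 ∧
    (preserving (components (rs.take t))).Nonempty

/-- The number of components of size `i` in `C`. -/
def cnt (C : Finset (Finset V)) (i : ℕ) : ℕ :=
  (C.filter (fun c => c.card = i)).card

/-- The number of components of size `i` in `C` that `p` places in cluster `y`. -/
def cntSide (C : Finset (Finset V)) (p : V → Bool) (y : Bool) (i : ℕ) : ℕ :=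
  (C.filter (fun c => (∀ v ∈ c, p v = y) ∧ c.card = i)).card

end Components

/-- `q = ⌈n^(1/7)⌉`. -/
def qParam (n : ℕ) : ℕ := ⌈(n : ℝ) ^ (1 / 7 : ℝ)⌉₊

/-- `w = 4 q^4 + 2`. -/
def wParam (n : ℕ) : ℕ := 4 * qParam n ^ 4 + 2

/-- `d = ⌈n^(13/14) / √(log n)⌉`. -/
def dParam (n : ℕ) : ℕ := ⌈(n : ℝ) ^ (13 / 14 : ℝ) / Real.sqrt (Real.log n)⌉₊

open Classical in
/-- `R(g) = {ℓ g : ℓ ∈ ℕ} ∩ {1, …, q}`; in particular `R(∞) = ∅`. -/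
def multiplesUpTo (q : ℕ) (g : ℕ∞) : Finset ℕ :=
  (Finset.Icc 1 q).filter (fun i => ∃ l : ℕ, (i : ℕ∞) = l * g)

/-- The greatest common divisor of a finite set, with `gcd ∅ = ∞`. -/
def gcdTop (A : Finset ℕ) : ℕ∞ :=
  if A = ∅ then ⊤ else ((A.gcd id : ℕ) : ℕ∞)

section Algorithm

variable {V : Type*} [Fintype V] [DecidableEq V]

/-- The set of popular component sizes: those `i ∈ {1, …, q}` with at least `w` components. -/
def popular (C : Finset (Finset V)) : Finset ℕ :=
  (Finset.Icc 1 (qParam (Fintype.card V))).filter (fun i => wParam (Fintype.card V) ≤ cnt C i)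

/-- The `C`-preserving partitions that are `(g, l)`-balanced: both clusters contain at least `l`
components with sizes in `R(g)`. -/
def properPartitions (g : ℕ∞) (l : ℕ) (C : Finset (Finset V)) : Finset (V → Bool) :=
  (preserving C).filter (fun p => ∀ y : Bool,
    l ≤ ∑ i ∈ multiplesUpTo (qParam (Fintype.card V)) g, cntSide C p y i)

/-- The `C`-preserving partitions that are closest to `p`. -/
def closest (p : V → Bool) (C : Finset (Finset V)) : Finset (V → Bool) :=
  (preserving C).filter (fun p' => ∀ p'' ∈ preserving C, hammingDist p p' ≤ hammingDist p p'')

/-- A rule resolving the unspecified choices of the first stage (ties in the `arg min`, and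
"any partition from"): given all requests so far, the current partition and a nonempty set of
admissible partitions, it selects one of them. -/
structure TieBreaking (V : Type*) where
  select : List (V × V) → (V → Bool) → Finset (V → Bool) → (V → Bool)
  select_mem : ∀ h p S, S.Nonempty → select h p S ∈ S

/-- The state of the algorithm within an epoch: the requests seen so far in the epoch, the current
partition, the popularity estimator, and whether the first stage is still running. -/
structure IcbState (V : Type*) where
  seen : List (V × V)
  part : V → Bool
  g : ℕ∞
  firstStage : Bool

/-- The state at the beginning of an epoch. -/
def IcbState.init (p₀ : V → Bool) : IcbState V := ⟨[], p₀, 1, true⟩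

/-- A step of the first stage, in the case where a component-preserving partition exists;
`C` is the component set after the request and `h` is the list of requests including it. -/
def firstStageStep (τ : TieBreaking V) (s : IcbState V) (h : List (V × V)) : IcbState V :=
  let C := components h
  let d := dParam (Fintype.card V)
  let candidate := τ.select h s.part (closest s.part C)
  let g := gcdTop (multiplesUpTo (qParam (Fintype.card V)) s.g ∩ popular C)
  if properPartitions g (2 * d) C = ∅ then ⟨h, s.part, g, false⟩
  else if candidate ∈ properPartitions g d C then ⟨h, candidate, g, true⟩
  else ⟨h, τ.select h s.part (properPartitions g (2 * d) C), g, true⟩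

/-- One step of the algorithm: the law of the next state. If no component-preserving partition
exists, the partition stays unchanged (and the epoch is over). Otherwise the first stage is
deterministic, and in the second stage a partition that is not component-preserving is replaced
by a uniformly random one that is. -/
def icbStep (τ : TieBreaking V) (s : IcbState V) (r : V × V) : PMF (IcbState V) :=
  let h := s.seen ++ [r]
  if hP : (preserving (components h)).Nonempty then
    if s.firstStage = true then PMF.pure (firstStageStep τ s h)
    else if s.part ∈ preserving (components h) then PMF.pure { s with seen := h }
    else (PMF.uniformOfFinset (preserving (components h)) hP).map
      (fun p => { s with seen := h, part := p })
  else PMF.pure { s with seen := h }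

/-- Service cost of request `r` plus reorganization cost when moving from state `s` to `s'`. -/
def stepCost (s : IcbState V) (r : V × V) (s' : IcbState V) : ℕ :=
  (if s.part r.1 ≠ s.part r.2 then 1 else 0) + hammingDist s.part s'.part

/-- The law of the total cost on a fixed list of requests, starting in state `s`. -/
def icbCost (τ : TieBreaking V) : IcbState V → List (V × V) → PMF ℕ
  | _, [] => PMF.pure 0
  | s, r :: rs => (icbStep τ s r).bind fun s' =>
      (icbCost τ s' rs).map fun c => stepCost s r s' + c

/-- The expected cost of the algorithm in an epoch with initial partition `p₀`, requests `rs`. -/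
def icbExpectedCost (τ : TieBreaking V) (p₀ : V → Bool) (rs : List (V × V)) : ℝ≥0∞ :=
  ∑' c : ℕ, icbCost τ (IcbState.init p₀) rs c * (c : ℝ≥0∞)

end Algorithm

end Bisection

end

open scoped ENNReal

set_option linter.unusedSectionVars false

/-! Write n for the number of elements. The deterministic first stage is paid for by `potential`;
the random second stage costs about n times the logarithm of the number of component-preserving
partitions left when it starts.

First stage: suppose one of the merged components has a size s in R(g), and g is still the gcd of
the popular sizes in R(g). Then g divides s, so by Bézout s is a signed sum of popular sizes with
small coefficients. Both clusters hold at least d components with sizes in R(g), hence also many of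
a single size, and these suffice to realise the sum by moving few components. A preserving partition
therefore lies within distance 4q^4 (`exists_near_preserving`). Such steps cost O(q^4), except for
occasional rebalancings of cost at most n, which `deficit` pays for. In every other step both merged
sizes lie outside R(g) or g changes; it may cost n, but it lowers `sizePotential` by at least q.
Since that quantity starts at n + O(q^7), there are only O(n/q + q^6) such steps.

Second stage: it begins when every preserving partition has fewer than 2d components with sizes in
R(g) in one of its clusters. Such a partition is determined by the choice of that cluster, its
components with sizes in R(g), and one bit for each component with size outside R(g)
(`card_preserving_le`). So the logarithm of their number is O(d log n + n/q + q^6). If a request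
shrinks the preserving set from P to P', a uniform element of P must be replaced with probability |P
\ P'|/|P|, which is at most log|P| - log|P'|. Replacing costs at most n, and the sum telescopes
(`sum_expectedCost_secondStage_le`).

For the given parameters n · d · log n dominates and is of order n^(27/14) · √(log n). -/

namespace Bisection

/-! ### Component sets as partitions of the ground set, and merging. -/

section

variable {V : Type*} [Fintype V] [DecidableEq V]

/-- The components in `C` are nonempty and every element lies in exactly one of them. -/
structure IsPart (C : Finset (Finset V)) : Prop where
  nonempty : ∀ c ∈ C, c.Nonempty
  cover : ∀ v : V, ∃ c ∈ C, v ∈ c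
  eq_of_mem : ∀ c ∈ C, ∀ c' ∈ C, ∀ v, v ∈ c → v ∈ c' → c = c'

theorem IsPart.componentOf_eq {C : Finset (Finset V)} (hC : IsPart C) {c : Finset V} (hc : c ∈ C)
    {v : V} (hv : v ∈ c) : componentOf C v = c := by
  have : C.filter (fun c => v ∈ c) = {c} := by
    ext c'
    simp only [Finset.mem_filter, Finset.mem_singleton]
    constructor
    · rintro ⟨h1, h2⟩
      exact hC.eq_of_mem c' h1 c hc v h2 hv
    · rintro rfl
      exact ⟨hc, hv⟩
  simp [componentOf, this]

theorem IsPart.componentOf_mem {C : Finset (Finset V)} (hC : IsPart C) (v : V) :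
    componentOf C v ∈ C := by
  obtain ⟨c, hc, hv⟩ := hC.cover v
  rwa [hC.componentOf_eq hc hv]

theorem IsPart.mem_componentOf {C : Finset (Finset V)} (hC : IsPart C) (v : V) :
    v ∈ componentOf C v := by
  obtain ⟨c, hc, hv⟩ := hC.cover v
  rwa [hC.componentOf_eq hc hv]

theorem IsPart.disjoint {C : Finset (Finset V)} (hC : IsPart C) {x y : Finset V} (hx : x ∈ C)
    (hy : y ∈ C) (hxy : x ≠ y) : Disjoint x y :=
  Finset.disjoint_left.2 fun v hvx hvy => hxy (hC.eq_of_mem x hx y hy v hvx hvy)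

theorem isPart_singletons : IsPart (Finset.univ.image (fun v : V => ({v} : Finset V))) where
  nonempty := by
    intro c hc
    obtain ⟨v, -, rfl⟩ := Finset.mem_image.1 hc
    exact Finset.singleton_nonempty v
  cover v := ⟨{v}, Finset.mem_image_of_mem _ (Finset.mem_univ v), Finset.mem_singleton_self v⟩
  eq_of_mem := by
    intro c hc c' hc' v hv hv'
    obtain ⟨a, -, rfl⟩ := Finset.mem_image.1 hc
    obtain ⟨b, -, rfl⟩ := Finset.mem_image.1 hc'
    rw [Finset.mem_singleton] at hv hv'
    rw [← hv, ← hv']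

/-- Replace the components `x` and `y` of `C` by their union. -/
def join (C : Finset (Finset V)) (x y : Finset V) : Finset (Finset V) :=
  insert (x ∪ y) (C \ {x, y})

theorem merge_eq_join (C : Finset (Finset V)) (r : V × V) :
    merge C r = join C (componentOf C r.1) (componentOf C r.2) := rfl

theorem IsPart.union_notMem {C : Finset (Finset V)} (hC : IsPart C) {x y : Finset V} (hx : x ∈ C) :
    x ∪ y ∉ C \ {x, y} := by
  intro h
  obtain ⟨h1, h2⟩ := Finset.mem_sdiff.1 h
  obtain ⟨v, hv⟩ := hC.nonempty x hx
  have := hC.eq_of_mem _ h1 x hx v (Finset.mem_union_left _ hv) hv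
  exact h2 (by simp [this])

theorem IsPart.join {C : Finset (Finset V)} (hC : IsPart C) {x y : Finset V} (hx : x ∈ C)
    (hy : y ∈ C) : IsPart (join C x y) where
  nonempty := by
    intro c hc
    rcases Finset.mem_insert.1 hc with rfl | hc
    · exact (hC.nonempty x hx).mono Finset.subset_union_left
    · exact hC.nonempty c (Finset.mem_sdiff.1 hc).1
  cover v := by
    obtain ⟨c, hc, hv⟩ := hC.cover v
    by_cases h : c = x ∨ c = y
    · refine ⟨x ∪ y, Finset.mem_insert_self _ _, ?_⟩
      rcases h with rfl | rfl
      · exact Finset.mem_union_left _ hv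
      · exact Finset.mem_union_right _ hv
    · exact ⟨c, Finset.mem_insert_of_mem (by simp [hc, h]), hv⟩
  eq_of_mem := by
    have key : ∀ c ∈ C \ {x, y}, ∀ v ∈ c, v ∉ x ∪ y := by
      intro c hc v hv hxy
      simp only [Finset.mem_sdiff, Finset.mem_insert, Finset.mem_singleton, not_or] at hc
      rcases Finset.mem_union.1 hxy with h | h
      · exact hc.2.1 (hC.eq_of_mem c hc.1 x hx v hv h)
      · exact hc.2.2 (hC.eq_of_mem c hc.1 y hy v hv h)
    intro c hc c' hc' v hv hv'
    rcases Finset.mem_insert.1 hc with rfl | hc <;> rcases Finset.mem_insert.1 hc' with rfl | hc'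
    · rfl
    · exact absurd hv (key c' hc' v hv')
    · exact absurd hv' (key c hc v hv)
    · exact hC.eq_of_mem c (Finset.mem_sdiff.1 hc).1 c' (Finset.mem_sdiff.1 hc').1 v hv hv'

/-- Used with `f = 1` to count components and with size weights to follow the potential. -/
theorem IsPart.sum_join {C : Finset (Finset V)} (hC : IsPart C) {x y : Finset V} (hx : x ∈ C)
    (hy : y ∈ C) (hxy : x ≠ y) (f : Finset V → ℕ) :
    ∑ c ∈ Bisection.join C x y, f c + (f x + f y) = ∑ c ∈ C, f c + f (x ∪ y) := by
  rw [Bisection.join, Finset.sum_insert (hC.union_notMem hx)]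
  have hsub : ({x, y} : Finset (Finset V)) ⊆ C := by
    intro z hz
    simp only [Finset.mem_insert, Finset.mem_singleton] at hz
    rcases hz with rfl | rfl <;> assumption
  have := Finset.sum_sdiff (f := f) hsub
  rw [Finset.sum_pair hxy] at this
  omega

theorem components_append_singleton (l : List (V × V)) (r : V × V) :
    components (l ++ [r]) = merge (components l) r := by
  simp [components, List.foldl_append]

theorem isPart_components (rs : List (V × V)) : IsPart (components rs) := by
  induction rs using List.reverseRecOn with
  | nil => exact isPart_singletons
  | append_singleton l r ih =>
    rw [components_append_singleton, merge_eq_join]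
    exact ih.join (ih.componentOf_mem _) (ih.componentOf_mem _)

theorem IsPart.sum_card {C : Finset (Finset V)} (hC : IsPart C) :
    ∑ c ∈ C, c.card = Fintype.card V := by
  have hd : (C : Set (Finset V)).PairwiseDisjoint id := fun x hx y hy hxy => hC.disjoint hx hy hxy
  have := Finset.card_biUnion (s := C) (t := id) hd
  simp only [id] at this
  rw [← this, ← Finset.card_univ]
  congr 1
  ext v
  simpa using hC.cover v

theorem IsPart.card_le {C : Finset (Finset V)} (hC : IsPart C) :
    C.card ≤ Fintype.card V := by
  rw [← hC.sum_card, Finset.card_eq_sum_ones]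
  exact Finset.sum_le_sum fun c hc => (hC.nonempty c hc).card_pos

theorem IsPart.card_join {C : Finset (Finset V)} (hC : IsPart C) {x y : Finset V} (hx : x ∈ C)
    (hy : y ∈ C) (hxy : x ≠ y) : (Bisection.join C x y).card + 1 = C.card := by
  have := hC.sum_join hx hy hxy (fun _ => 1)
  simp only [← Finset.card_eq_sum_ones] at this
  omega

theorem mem_preserving {C : Finset (Finset V)} {p : V → Bool} :
    p ∈ preserving C ↔ IsBalanced p ∧ ∀ c ∈ C, ∀ u ∈ c, ∀ v ∈ c, p u = p v := by
  simp [preserving]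

theorem preserving_join_subset {C : Finset (Finset V)} {x y : Finset V} :
    preserving (Bisection.join C x y) ⊆ preserving C := by
  intro p hp
  rw [mem_preserving] at hp ⊢
  refine ⟨hp.1, fun c hc u hu v hv => ?_⟩
  by_cases h : c = x ∨ c = y
  · have hsub : c ⊆ x ∪ y := by
      rcases h with rfl | rfl
      · exact Finset.subset_union_left
      · exact Finset.subset_union_right
    exact hp.2 _ (Finset.mem_insert_self _ _) u (hsub hu) v (hsub hv)
  · exact hp.2 c (Finset.mem_insert_of_mem (by simp [hc, h])) u hu v hv

/-- The components of `C` with size in `R` that `p` places in cluster `y`. -/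
def sideComps (C : Finset (Finset V)) (p : V → Bool) (y : Bool) (R : Finset ℕ) :
    Finset (Finset V) :=
  C.filter (fun c => (∀ v ∈ c, p v = y) ∧ c.card ∈ R)

theorem sum_cntSide (C : Finset (Finset V)) (p : V → Bool) (y : Bool) (R : Finset ℕ) :
    ∑ i ∈ R, cntSide C p y i = (sideComps C p y R).card := by
  have : ∀ c ∈ sideComps C p y R, c.card ∈ R := fun c hc => (Finset.mem_filter.1 hc).2.2
  rw [Finset.card_eq_sum_card_fiberwise this]
  refine Finset.sum_congr rfl fun i hi => ?_
  unfold cntSide sideComps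
  rw [Finset.filter_filter]
  congr 1
  ext c
  simp only [Finset.mem_filter]
  constructor
  · rintro ⟨h1, h2, h3⟩
    exact ⟨h1, ⟨h2, h3 ▸ hi⟩, h3⟩
  · rintro ⟨h1, ⟨h2, -⟩, h3⟩
    exact ⟨h1, h2, h3⟩

/-- A component that no longer counts is `x` or `y`, or contains an element on which `p` and `p'`
differ; each such element spoils only its own component. No assumption on `p'` is needed. -/
theorem IsPart.card_sideComps_le {C : Finset (Finset V)} (hC : IsPart C) {x y : Finset V}
    (p p' : V → Bool) (b : Bool) (R : Finset ℕ) :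
    (sideComps C p b R).card ≤
      (sideComps (Bisection.join C x y) p' b R).card + (hammingDist p p' + 2) := by
  have hsub : sideComps C p b R ⊆ sideComps (Bisection.join C x y) p' b R ∪
      ((Finset.univ.filter fun v => p v ≠ p' v).image (componentOf C) ∪ {x, y}) := by
    intro c hc
    obtain ⟨hcC, hcp, hcR⟩ := Finset.mem_filter.1 hc
    simp only [Finset.mem_union]
    by_cases hxy : c ∈ ({x, y} : Finset (Finset V))
    · exact Or.inr (Or.inr hxy)
    by_cases hd : ∃ v ∈ c, p v ≠ p' v
    · obtain ⟨v, hv, hne⟩ := hd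
      refine Or.inr (Or.inl (Finset.mem_image.2 ⟨v, by simp [hne], hC.componentOf_eq hcC hv⟩))
    · push Not at hd
      refine Or.inl (Finset.mem_filter.2 ⟨Finset.mem_insert_of_mem
        (Finset.mem_sdiff.2 ⟨hcC, hxy⟩), fun v hv => ?_, hcR⟩)
      rw [← hd v hv, hcp v hv]
  calc (sideComps C p b R).card ≤ _ := Finset.card_le_card hsub
    _ ≤ _ := (Finset.card_union_le _ _)
    _ ≤ _ := by
      gcongr
      refine (Finset.card_union_le _ _).trans ?_
      gcongr
      · exact Finset.card_image_le
      · exact Finset.card_le_two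

end

/-! ### Bézout combinations with bounded coefficients, realised by families of sets. -/

theorem exists_int_combination {J : Finset ℕ} {g s : ℕ} (hg : J.gcd id = g) (hs : g ∣ s) :
    ∃ z : ℕ → ℤ, ∑ j ∈ J, z j * (j : ℤ) = s := by
  obtain ⟨k, rfl⟩ := hs
  obtain ⟨a, ha⟩ := Finset.gcd_eq_sum_mul J (fun j : ℕ => (j : ℤ))
  have h : J.gcd (fun j : ℕ => (j : ℤ)) = (g : ℤ) := by
    rw [← hg]
    clear hg ha
    induction J using Finset.induction_on with
    | empty => simp
    | insert x S hx ih => 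
      rw [Finset.gcd_insert, Finset.gcd_insert, ih]
      rfl
  refine ⟨fun j => k * a j, ?_⟩
  rw [h] at ha
  push_cast
  rw [ha, Finset.sum_mul]
  refine Finset.sum_congr rfl fun i _ => ?_
  ring

/-- Signed sums of the elements of `J`, with prescribed signs, small coefficients and two extra
summands from `ia` and `ib`, represent every small multiple of the gcd of `J`. -/
theorem exists_signed_combination {J : Finset ℕ} {q g s ia ib : ℕ} (hJ : J ⊆ Finset.Icc 1 q)
    (hg : J.gcd id = g) (hs : g ∣ s) (hsq : s ≤ q) (hia : ia ∈ Finset.Icc 1 q)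
    (hib : ib ∈ Finset.Icc 1 q) (σ : ℕ → Bool) :
    ∃ (k : ℕ → ℕ) (a b : ℕ), (∀ j, k j ≤ q ^ 2) ∧ a ≤ q + q ^ 4 ∧ b ≤ q + q ^ 4 ∧
      a * ia + b * ib ≤ q + q ^ 4 ∧
      ∑ j ∈ J.filter (fun j => σ j = true), k j * j + b * ib =
        s + (∑ j ∈ J.filter (fun j => σ j = false), k j * j + a * ia) := by
  obtain ⟨z, hz⟩ := exists_int_combination hg hs
  rw [Finset.mem_Icc] at hia hib
  -- Changing a coefficient by a multiple of `M` changes the sum by a multiple of `M`, which copies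
  -- of `ia` or `ib` can absorb. So each sign-adjusted coefficient is replaced by its residue in
  -- `[0, M)`, where `M ≤ q ^ 2`.
  set M : ℤ := ia * ib with hM
  have hMpos : 0 < M := by
    have h1 : (0 : ℤ) < ia := by exact_mod_cast hia.1
    have h2 : (0 : ℤ) < ib := by exact_mod_cast hib.1
    positivity
  have hMle : M ≤ (q : ℤ) ^ 2 := by
    have h1 : (ia : ℤ) ≤ q := by exact_mod_cast hia.2
    have h2 : (ib : ℤ) ≤ q := by exact_mod_cast hib.2
    rw [hM, pow_two]
    gcongr
  set ε : ℕ → ℤ := fun j => if σ j = true then 1 else -1 with hε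
  have hεε : ∀ j, ε j * ε j = 1 := fun j => by simp only [hε]; split_ifs <;> norm_num
  set k : ℕ → ℕ := fun j => ((ε j * z j) % M).toNat with hk
  have hkz : ∀ j, (k j : ℤ) = (ε j * z j) % M := fun j =>
    Int.toNat_of_nonneg (Int.emod_nonneg _ hMpos.ne')
  have hkM : ∀ j, (k j : ℤ) ≤ (q : ℤ) ^ 2 := fun j => by
    rw [hkz]
    exact (Int.emod_lt_of_pos _ hMpos).le.trans hMle
  have hdvd : M ∣ (s : ℤ) - ∑ j ∈ J, ε j * k j * j := by
    rw [← hz, ← Finset.sum_sub_distrib]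
    refine Finset.dvd_sum fun j _ => ?_
    have h1 : M ∣ ε j * z j - k j := by
      rw [hkz]
      exact Int.dvd_self_sub_emod
    have h2 : z j * (j : ℤ) - ε j * k j * j = (ε j * z j - k j) * (ε j * j) := by
      linear_combination (-(z j * (j : ℤ))) * hεε j
    rw [h2]
    exact h1.mul_right _
  obtain ⟨m, hm⟩ := hdvd
  have hA0 : ∑ j ∈ J, ((q : ℤ) ^ 2 * q) ≤ (q : ℤ) ^ 4 := by
    rw [Finset.sum_const, nsmul_eq_mul]
    have : J.card ≤ q := by simpa using Finset.card_le_card hJ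
    have : (J.card : ℤ) ≤ q := by exact_mod_cast this
    calc (J.card : ℤ) * ((q : ℤ) ^ 2 * q) ≤ q * ((q : ℤ) ^ 2 * q) := by gcongr
      _ = _ := by ring
  have habs : |∑ j ∈ J, ε j * k j * j| ≤ (q : ℤ) ^ 4 := by
    refine (Finset.abs_sum_le_sum_abs _ _).trans (le_trans (Finset.sum_le_sum fun j hj => ?_) hA0)
    have h1 : |ε j| = 1 := by simp only [hε]; split_ifs <;> simp
    rw [abs_mul, abs_mul, h1, one_mul, Nat.abs_cast, Nat.abs_cast]
    have h2 : (j : ℤ) ≤ q := by exact_mod_cast (Finset.mem_Icc.1 (hJ hj)).2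
    have := hkM j
    gcongr
  have hmM : |M * m| ≤ (q : ℤ) + (q : ℤ) ^ 4 := by
    rw [← hm]
    refine (abs_sub _ _).trans ?_
    rw [Nat.abs_cast]
    have : (s : ℤ) ≤ q := by exact_mod_cast hsq
    gcongr
  have hsplit : ∑ j ∈ J, ε j * k j * j =
      ∑ j ∈ J.filter (fun j => σ j = true), (k j : ℤ) * j -
        ∑ j ∈ J.filter (fun j => σ j = false), (k j : ℤ) * j := by
    rw [Finset.sum_filter, Finset.sum_filter, ← Finset.sum_sub_distrib]
    refine Finset.sum_congr rfl fun j _ => ?_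
    simp only [hε]
    cases σ j <;> simp
  have hkq : ∀ j, k j ≤ q ^ 2 := fun j => by exact_mod_cast hkM j
  have hle : ∀ a b c : ℕ, 1 ≤ b → a * b ≤ c → a ≤ c := fun a b c h h' =>
    (Nat.le_mul_of_pos_right a h).trans h'
  -- The remaining error is `M * m`. Its sign decides whether it is covered by `m * ia` copies of
  -- `ib` or by `|m| * ib` copies of `ia`.
  rcases le_total 0 m with h0 | h0
  · lift m to ℕ using h0
    have hb : m * ia * ib ≤ q + q ^ 4 := by
      have := (le_abs_self _).trans hmM
      rw [hM] at this
      have h2 : ((m * ia * ib : ℕ) : ℤ) ≤ ((q + q ^ 4 : ℕ) : ℤ) := by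
        push_cast; linarith
      exact_mod_cast h2
    refine ⟨k, 0, m * ia, hkq, Nat.zero_le _, hle _ _ _ hib.1 hb, by simpa using hb, ?_⟩
    zify
    rw [hsplit] at hm
    rw [hM] at hm
    linarith
  · obtain ⟨m', rfl⟩ : ∃ m' : ℕ, m = -(m' : ℤ) := ⟨m.natAbs, by omega⟩
    have hb : m' * ib * ia ≤ q + q ^ 4 := by
      have := (neg_le_abs _).trans hmM
      rw [hM] at this
      have h2 : ((m' * ib * ia : ℕ) : ℤ) ≤ ((q + q ^ 4 : ℕ) : ℤ) := by
        push_cast; linarith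
      exact_mod_cast h2
    refine ⟨k, m' * ib, 0, hkq, hle _ _ _ hia.1 hb, Nat.zero_le _, by simpa using hb, ?_⟩
    zify
    rw [hsplit] at hm
    rw [hM] at hm
    linarith

section

variable {V : Type*} [DecidableEq V]

/-- From a family with sufficiently many sets of each size, one can select a subfamily with
prescribed numbers of sets of each size. -/
theorem exists_subfamily (S : Finset (Finset V)) (I : Finset ℕ) (α : ℕ → ℕ)
    (h : ∀ i ∈ I, α i ≤ (S.filter fun c => c.card = i).card) :
    ∃ A ⊆ S, ∑ c ∈ A, c.card = ∑ i ∈ I, α i * i := by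
  have : ∀ i, ∃ T ⊆ S.filter (fun c => c.card = i), i ∈ I → T.card = α i := by
    intro i
    by_cases hi : i ∈ I
    · obtain ⟨T, hT, hc⟩ := Finset.exists_subset_card_eq (h i hi)
      exact ⟨T, hT, fun _ => hc⟩
    · exact ⟨∅, Finset.empty_subset _, fun h => absurd h hi⟩
  choose T hT hTc using this
  have hcard : ∀ i, ∀ c ∈ T i, c.card = i := fun i c hc => (Finset.mem_filter.1 (hT i hc)).2
  refine ⟨I.biUnion T, ?_, ?_⟩
  · intro c hc
    obtain ⟨i, -, hi⟩ := Finset.mem_biUnion.1 hc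
    exact (Finset.mem_filter.1 (hT i hi)).1
  · rw [Finset.sum_biUnion]
    · refine Finset.sum_congr rfl fun i hi => ?_
      rw [Finset.sum_congr rfl (hcard i), Finset.sum_const, hTc i hi, smul_eq_mul]
    · intro i _ j _ hij
      refine Finset.disjoint_left.2 fun c hc hc' => hij ?_
      rw [← hcard i c hc, ← hcard j c hc']

/-- Two families that share enough sets of each popular size, and both have many sets of one
size, contain subfamilies whose masses differ by a given small multiple of the gcd. -/
theorem exists_compensation {Sa Sb : Finset (Finset V)} {J : Finset ℕ} {q g s ia ib : ℕ}
    (hJ : J ⊆ Finset.Icc 1 q) (hg : J.gcd id = g) (hs : g ∣ s) (hsq : s ≤ q)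
    (hia : ia ∈ Finset.Icc 1 q) (hib : ib ∈ Finset.Icc 1 q)
    (hpop : ∀ j ∈ J, 4 * q ^ 4 + 1 ≤
      (Sa.filter fun c => c.card = j).card + (Sb.filter fun c => c.card = j).card)
    (hca : 3 * q ^ 4 ≤ (Sa.filter fun c => c.card = ia).card)
    (hcb : 3 * q ^ 4 ≤ (Sb.filter fun c => c.card = ib).card) :
    ∃ A ⊆ Sa, ∃ B ⊆ Sb, ∑ c ∈ B, c.card = s + ∑ c ∈ A, c.card ∧
      s + ∑ c ∈ A, c.card + ∑ c ∈ B, c.card ≤ 4 * q ^ 4 := by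
  have hq1 : 1 ≤ q := (Finset.mem_Icc.1 hia).1.trans (Finset.mem_Icc.1 hia).2
  have hq2 : q ^ 2 ≤ q ^ 4 := Nat.pow_le_pow_right hq1 (by norm_num)
  have hq4 : q ≤ q ^ 4 := Nat.le_self_pow (by norm_num) q
  -- Each size is drawn from a family that has at least `2 * q ^ 4` sets of it; the popularity
  -- hypothesis guarantees that one of the two does.
  let σ : ℕ → Bool := fun j => decide (2 * q ^ 4 ≤ (Sb.filter fun c => c.card = j).card)
  obtain ⟨k, a, b, hk, ha, hb, hab, heq⟩ :=
    exists_signed_combination hJ hg hs hsq hia hib σ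
  -- The extra size `i0` may itself be one of the sizes in `J`, so its supply must cover `q ^ 2 + e`
  -- sets. As `e ≤ q + q ^ 4`, having `3 * q ^ 4` is enough.
  have aux : ∀ (S : Finset (Finset V)) (P : ℕ → Prop) [DecidablePred P] (i0 e : ℕ),
      i0 ∈ Finset.Icc 1 q →
      (∀ j ∈ J, P j → q ^ 2 ≤ (S.filter fun c => c.card = j).card) →
      q ^ 2 + e ≤ (S.filter fun c => c.card = i0).card →
      ∃ A ⊆ S, ∑ c ∈ A, c.card = ∑ j ∈ J.filter P, k j * j + e * i0 := by
    intro S P _ i0 e hi0 hP he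
    obtain ⟨A, hA, hsum⟩ := exists_subfamily S (Finset.Icc 1 q)
      (fun j => (if j ∈ J.filter P then k j else 0) + if j = i0 then e else 0) (by
        intro j _
        have := hk j
        split_ifs with h1 h2 h2
        · subst h2; omega
        · exact (by omega : k j + 0 ≤ q ^ 2).trans
            (hP j (Finset.mem_filter.1 h1).1 (Finset.mem_filter.1 h1).2)
        · subst h2; omega
        · exact Nat.zero_le _)
    refine ⟨A, hA, hsum.trans ?_⟩
    simp only [add_mul, Finset.sum_add_distrib, ite_mul, zero_mul]
    congr 1
    · rw [← Finset.sum_filter]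
      refine Finset.sum_congr ?_ fun _ _ => rfl
      ext j
      simp only [Finset.mem_filter]
      exact ⟨fun h => h.2, fun h => ⟨hJ h.1, h⟩⟩
    · rw [Finset.sum_ite_eq' (Finset.Icc 1 q) i0, if_pos hi0]
  obtain ⟨A, hA, hAs⟩ := aux Sa (fun j => σ j = false) ia a hia (by
    intro j hj hσ
    have h1 := hpop j hj
    simp only [σ, decide_eq_false_iff_not] at hσ
    omega) (by omega)
  obtain ⟨B, hB, hBs⟩ := aux Sb (fun j => σ j = true) ib b hib (by
    intro j hj hσ
    simp only [σ, decide_eq_true_eq] at hσ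
    omega) (by omega)
  have hkey : ∑ j ∈ J.filter (fun j => σ j = false), k j * j +
      ∑ j ∈ J.filter (fun j => σ j = true), k j * j ≤ q ^ 4 := by
    have h1 : ∑ j ∈ J.filter (fun j => σ j = false), k j * j +
        ∑ j ∈ J.filter (fun j => σ j = true), k j * j = ∑ j ∈ J, k j * j := by
      rw [Finset.sum_filter, Finset.sum_filter, ← Finset.sum_add_distrib]
      refine Finset.sum_congr rfl fun j _ => ?_
      cases σ j <;> simp
    rw [h1]
    calc ∑ j ∈ J, k j * j ≤ ∑ j ∈ J, q ^ 2 * q := Finset.sum_le_sum fun j hj =>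
          Nat.mul_le_mul (hk j) (Finset.mem_Icc.1 (hJ hj)).2
      _ = J.card * (q ^ 2 * q) := by rw [Finset.sum_const, smul_eq_mul]
      _ ≤ q * (q ^ 2 * q) := by
        gcongr
        simpa using Finset.card_le_card hJ
      _ = q ^ 4 := by ring
  refine ⟨A, hA, B, hB, by omega, by omega⟩

end

/-! ### Repairing a partition after a merge by moving few components. -/

section

variable {V : Type*} [Fintype V] [DecidableEq V]

/-- Flipping the side of a component `x` and of families `A`, `B` of further components of
matching mass turns a partition separating `x` from `y` into one that preserves `x ∪ y`. -/
theorem exists_rebalanced {C : Finset (Finset V)} (hC : IsPart C) {x y : Finset V} (hx : x ∈ C)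
    (hy : y ∈ C) {p : V → Bool} (hp : p ∈ preserving C) {a : Bool} (hpx : ∀ v ∈ x, p v = a)
    (hpy : ∀ v ∈ y, p v = !a) {A B : Finset (Finset V)} (hA : A ⊆ C \ {x, y})
    (hB : B ⊆ C \ {x, y}) (hpA : ∀ c ∈ A, ∀ v ∈ c, p v = a) (hpB : ∀ c ∈ B, ∀ v ∈ c, p v = !a)
    (hmass : ∑ c ∈ B, c.card = x.card + ∑ c ∈ A, c.card) :
    ∃ p' ∈ preserving (join C x y),
      hammingDist p p' ≤ x.card + ∑ c ∈ A, c.card + ∑ c ∈ B, c.card := by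
  have hxy : x ≠ y := by
    rintro rfl
    obtain ⟨v, hv⟩ := hC.nonempty x hx
    have := (hpx v hv).symm.trans (hpy v hv)
    cases a <;> simp at this
  have hcard : ∀ T : Finset (Finset V), T ⊆ C → (T.biUnion id).card = ∑ c ∈ T, c.card := fun T hT =>
    Finset.card_biUnion fun c hc c' hc' hne => hC.disjoint (hT hc) (hT hc') hne
  have hAC : A ⊆ C := hA.trans Finset.sdiff_subset
  have hBC : B ⊆ C := hB.trans Finset.sdiff_subset
  have hxA : insert x A ⊆ C := Finset.insert_subset hx hAC
  have hxnA : x ∉ A := fun h => by simpa using hA h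
  have hxnB : x ∉ B := fun h => by simpa using hB h
  have hynA : y ∉ A := fun h => by simpa using hA h
  have hynB : y ∉ B := fun h => by simpa using hB h
  set F : Finset V := (insert x A).biUnion id with hF
  set G : Finset V := B.biUnion id with hG
  have hFa : ∀ v ∈ F, p v = a := by
    intro v hv
    obtain ⟨c, hc, hvc⟩ := Finset.mem_biUnion.1 hv
    rcases Finset.mem_insert.1 hc with rfl | hc
    · exact hpx v hvc
    · exact hpA c hc v hvc
  have hGb : ∀ v ∈ G, p v = !a := by
    intro v hv
    obtain ⟨c, hc, hvc⟩ := Finset.mem_biUnion.1 hv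
    exact hpB c hc v hvc
  have hFc : F.card = x.card + ∑ c ∈ A, c.card := by
    rw [hF, hcard _ hxA, Finset.sum_insert hxnA]
  have hGc : G.card = x.card + ∑ c ∈ A, c.card := by rw [hG, hcard _ hBC, hmass]
  have hmemC : ∀ c ∈ C, ∀ T ⊆ C, ∀ v ∈ c, (v ∈ T.biUnion id ↔ c ∈ T) := by
    intro c hc T hT v hv
    constructor
    · intro h
      obtain ⟨c', hc', hv'⟩ := Finset.mem_biUnion.1 h
      rwa [hC.eq_of_mem c hc c' (hT hc') v hv hv']
    · intro h
      exact Finset.mem_biUnion.2 ⟨c, h, hv⟩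
  -- `F ∪ G` is a union of whole components, so flipping it splits none. Cluster `a` loses `F` and
  -- gains `G`, which have equal cardinality.
  set p' : V → Bool := fun v => if v ∈ F ∪ G then !(p v) else p v with hp'
  have hp'a : (Finset.univ.filter fun v => p' v = a) =
      ((Finset.univ.filter fun v => p v = a) \ F) ∪ G := by
    ext v
    simp only [hp', Finset.mem_filter, Finset.mem_univ, true_and, Finset.mem_union,
      Finset.mem_sdiff]
    by_cases h1 : v ∈ F
    · have h2 : v ∉ G := fun h => by
        have := (hFa v h1).symm.trans (hGb v h)
        cases a <;> simp at this
      simp [h1, h2, hFa v h1]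
    · by_cases h2 : v ∈ G
      · simp [h2, hGb v h2]
      · simp [h1, h2]
  rw [mem_preserving] at hp
  have hcardEq : (Finset.univ.filter fun v => p' v = a).card =
      (Finset.univ.filter fun v => p v = a).card := by
    have hsub : F ⊆ Finset.univ.filter fun v => p v = a := fun v hv => by simp [hFa v hv]
    have hdis : Disjoint ((Finset.univ.filter fun v => p v = a) \ F) G := by
      refine Finset.disjoint_left.2 fun v hv hv' => ?_
      have h1 : p v = a := by simpa using (Finset.mem_sdiff.1 hv).1
      have := h1.symm.trans (hGb v hv')
      cases a <;> simp at this
    rw [hp'a, Finset.card_union_of_disjoint hdis, Finset.card_sdiff_of_subset hsub, hGc, ← hFc]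
    have := Finset.card_le_card hsub
    omega
  have hcompl : ∀ f : V → Bool, (Finset.univ.filter fun v => f v = a).card +
      (Finset.univ.filter fun v => f v = !a).card = Fintype.card V := by
    intro f
    rw [← Finset.card_univ, ← Finset.card_filter_add_card_filter_not (s := Finset.univ)
      (fun v => f v = a)]
    congr 2
    ext v
    cases a <;> simp
  refine ⟨p', mem_preserving.2 ⟨?_, ?_⟩, ?_⟩
  · have h1 := hp.1 a
    have h2 := hcompl p'
    intro b
    by_cases hb : b = a
    · subst hb; omega
    · have : b = !a := by revert hb; cases a <;> cases b <;> simp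
      subst this; omega
  · intro c hc u hu v hv
    rcases Finset.mem_insert.1 hc with rfl | hc
    · have key : ∀ v ∈ x ∪ y, p' v = !a := by
        intro v hv
        rcases Finset.mem_union.1 hv with h | h
        · have : v ∈ F := (hmemC x hx _ hxA v h).2 (Finset.mem_insert_self _ _)
          simp [hp', this, hpx v h]
        · have h1 : v ∉ F := fun h' => by
            have := (hmemC y hy _ hxA v h).1 h'
            simp [hxy.symm, hynA] at this
          have h2 : v ∉ G := fun h' => hynB ((hmemC y hy _ hBC v h).1 h')
          simp [hp', h1, h2, hpy v h]
      rw [key u hu, key v hv]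
    · have hcC := (Finset.mem_sdiff.1 hc).1
      have h1 := hp.2 c hcC u hu v hv
      simp only [hp', Finset.mem_union, hF, hG, hmemC c hcC _ hxA u hu, hmemC c hcC _ hxA v hv,
        hmemC c hcC _ hBC u hu, hmemC c hcC _ hBC v hv, h1]
  · have : hammingDist p p' ≤ (F ∪ G).card := by
      refine Finset.card_le_card fun v hv => ?_
      by_contra h
      rw [Finset.mem_filter] at hv
      exact hv.2 (if_neg h).symm
    refine this.trans ((Finset.card_union_le _ _).trans ?_)
    omega

theorem mem_multiplesUpTo_coe {q g i : ℕ} :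
    i ∈ multiplesUpTo q (g : ℕ∞) ↔ i ∈ Finset.Icc 1 q ∧ g ∣ i := by
  simp only [multiplesUpTo, Finset.mem_filter]
  refine and_congr_right fun _ => ⟨?_, ?_⟩
  · rintro ⟨l, hl⟩
    exact ⟨l, by rw [mul_comm]; exact_mod_cast hl⟩
  · rintro ⟨l, rfl⟩
    exact ⟨l, by rw [mul_comm]; push_cast; rfl⟩

theorem multiplesUpTo_subset (q : ℕ) (g : ℕ∞) : multiplesUpTo q g ⊆ Finset.Icc 1 q := by
  intro i hi
  simp only [multiplesUpTo, Finset.mem_filter] at hi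
  exact hi.1

/-- If both clusters contain many components with sizes in `R`, then some size in `R` occurs often
in a given cluster even after discarding two components. -/
theorem exists_frequent_size {C : Finset (Finset V)} {p : V → Bool} {b : Bool} {R : Finset ℕ}
    {q m : ℕ} (hR : R ⊆ Finset.Icc 1 q) (x y : Finset V)
    (h : q * (m + 2) < (sideComps C p b R).card) :
    ∃ i ∈ R, m ≤ ((C \ {x, y}).filter (fun c => ∀ v ∈ c, p v = b) |>.filter
      fun c => c.card = i).card := by
  have hmaps : ∀ c ∈ sideComps C p b R, c.card ∈ R := fun c hc => (Finset.mem_filter.1 hc).2.2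
  have hRq : R.card ≤ q := by simpa using Finset.card_le_card hR
  obtain ⟨i, hi, hlt⟩ := Finset.exists_lt_card_fiber_of_mul_lt_card_of_maps_to hmaps
    (lt_of_le_of_lt (Nat.mul_le_mul_right (m + 2) hRq) h)
  refine ⟨i, hi, ?_⟩
  have hsub : (sideComps C p b R).filter (fun c => c.card = i) ⊆
      (((C \ {x, y}).filter (fun c => ∀ v ∈ c, p v = b)).filter fun c => c.card = i) ∪ {x, y} := by
    intro c hc
    obtain ⟨hc1, hci⟩ := Finset.mem_filter.1 hc
    obtain ⟨hcC, hcp, -⟩ := Finset.mem_filter.1 hc1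
    by_cases hxy : c ∈ ({x, y} : Finset (Finset V))
    · exact Finset.mem_union_right _ hxy
    · exact Finset.mem_union_left _ (Finset.mem_filter.2 ⟨Finset.mem_filter.2
        ⟨Finset.mem_sdiff.2 ⟨hcC, hxy⟩, hcp⟩, hci⟩)
  have h1 := (Finset.card_le_card hsub).trans (Finset.card_union_le _ _)
  have h2 : ({x, y} : Finset (Finset V)).card ≤ 2 := Finset.card_le_two
  omega

/-- When a component with size in `R(g)` is merged and `g` is still the gcd of the popular sizes,
a component-preserving partition exists nearby. -/
theorem exists_near_preserving {C : Finset (Finset V)} (hC : IsPart C) {x y : Finset V}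
    (hx : x ∈ C) (hy : y ∈ C) {p : V → Bool} (hp : p ∈ preserving C) {q g : ℕ}
    {J : Finset ℕ} (hJ : J ⊆ Finset.Icc 1 q) (hg : J.gcd id = g)
    (hpop : ∀ j ∈ J, 4 * q ^ 4 + 2 ≤ cnt (join C x y) j)
    (hside : ∀ b, q * (3 * q ^ 4 + 2) < (sideComps C p b (multiplesUpTo q g)).card)
    (hxR : x.card ∈ multiplesUpTo q g) :
    ∃ p' ∈ preserving (join C x y), hammingDist p p' ≤ 4 * q ^ 4 := by
  obtain ⟨u, hu⟩ := hC.nonempty x hx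
  obtain ⟨v, hv⟩ := hC.nonempty y hy
  have hp2 := (mem_preserving.1 hp).2
  -- If both components already share a cluster, `p` itself survives the merge.
  by_cases huv : p u = p v
  · refine ⟨p, mem_preserving.2 ⟨(mem_preserving.1 hp).1, fun c hc s hs t ht => ?_⟩, by simp⟩
    rcases Finset.mem_insert.1 hc with rfl | hc
    · have key : ∀ s ∈ x ∪ y, p s = p u := by
        intro s hs
        rcases Finset.mem_union.1 hs with h | h
        · exact hp2 x hx s h u hu
        · rw [huv]; exact hp2 y hy s h v hv
      rw [key s hs, key t ht]
    · exact hp2 c (Finset.mem_sdiff.1 hc).1 s hs t ht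
  have hpx : ∀ s ∈ x, p s = p u := fun s hs => hp2 x hx s hs u hu
  have hpy : ∀ s ∈ y, p s = !(p u) := fun s hs => by
    rw [hp2 y hy s hs v hv]
    revert huv
    cases p u <;> cases p v <;> simp
  obtain ⟨hxq, hgx⟩ := mem_multiplesUpTo_coe.1 hxR
  obtain ⟨ia, hia, hca⟩ := exists_frequent_size (multiplesUpTo_subset q g) x y (hside (p u))
  obtain ⟨ib, hib, hcb⟩ := exists_frequent_size (multiplesUpTo_subset q g) x y (hside (!(p u)))
  obtain ⟨A, hA, B, hB, hm, hle⟩ := exists_compensation hJ hg hgx (Finset.mem_Icc.1 hxq).2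
    (mem_multiplesUpTo_coe.1 hia).1 (mem_multiplesUpTo_coe.1 hib).1 (by
      intro j hj
      have h1 := hpop j hj
      rw [← Finset.card_union_of_disjoint]
      -- The merged component `x ∪ y` may have size `j` but cannot be moved; this is why popularity
      -- asks for one component more than `exists_compensation`.
      · have hsub : (join C x y).filter (fun c => c.card = j) ⊆ insert (x ∪ y)
            ((((C \ {x, y}).filter fun c => ∀ s ∈ c, p s = p u).filter fun c => c.card = j) ∪
            (((C \ {x, y}).filter fun c => ∀ s ∈ c, p s = !(p u)).filter fun c => c.card = j)) := by
          intro c hc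
          obtain ⟨hc1, hcj⟩ := Finset.mem_filter.1 hc
          rcases Finset.mem_insert.1 hc1 with rfl | hc1
          · exact Finset.mem_insert_self _ _
          · refine Finset.mem_insert_of_mem (Finset.mem_union.2 ?_)
            have hcC := (Finset.mem_sdiff.1 hc1).1
            obtain ⟨t, ht⟩ := hC.nonempty c hcC
            by_cases h : p t = p u
            · exact Or.inl (Finset.mem_filter.2 ⟨Finset.mem_filter.2 ⟨hc1, fun s hs =>
                (hp2 c hcC s hs t ht).trans h⟩, hcj⟩)
            · refine Or.inr (Finset.mem_filter.2 ⟨Finset.mem_filter.2 ⟨hc1, fun s hs =>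
                (hp2 c hcC s hs t ht).trans ?_⟩, hcj⟩)
              revert h
              cases p t <;> cases p u <;> simp
        have h2 := (Finset.card_le_card hsub).trans (Finset.card_insert_le _ _)
        unfold cnt at h1
        omega
      · refine Finset.disjoint_left.2 fun c hc hc' => ?_
        obtain ⟨h1, h2⟩ := Finset.mem_filter.1 (Finset.mem_filter.1 hc).1
        obtain ⟨-, h3⟩ := Finset.mem_filter.1 (Finset.mem_filter.1 hc').1
        obtain ⟨t, ht⟩ := hC.nonempty c (Finset.mem_sdiff.1 h1).1
        have := (h2 t ht).symm.trans (h3 t ht)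
        cases h : p u <;> simp [h] at this) hca hcb
  obtain ⟨p', hp', hd⟩ := exists_rebalanced hC hx hy hp hpx hpy
    (hA.trans (Finset.filter_subset _ _)) (hB.trans (Finset.filter_subset _ _))
    (fun c hc => (Finset.mem_filter.1 (hA hc)).2) (fun c hc => (Finset.mem_filter.1 (hB hc)).2) hm
  exact ⟨p', hp', hd.trans hle⟩

theorem join_comm (C : Finset (Finset V)) (x y : Finset V) : join C x y = join C y x := by
  rw [join, join, Finset.union_comm, Finset.pair_comm]

end

/-! ### Counting component-preserving partitions. -/

section

variable {V : Type*} [Fintype V] [DecidableEq V]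

/-- Counts the ways to pick fewer than `k` components; its logarithm contributes the `d log n` term.
-/
theorem sum_choose_le_pow {N m : ℕ} (h : m ≤ N) (k : ℕ) :
    ∑ i ∈ Finset.range k, m.choose i ≤ (N + 1) ^ k := by
  induction k with
  | zero => simp
  | succ k ih =>
    rw [Finset.sum_range_succ]
    have h1 : m.choose k ≤ N ^ k := (Nat.choose_le_pow m k).trans (Nat.pow_le_pow_left h k)
    rcases Nat.eq_zero_or_pos N with rfl | hN
    · obtain rfl : m = 0 := by omega
      rcases k with _ | k <;> simp_all
    · have h2 : N ^ k ≤ (N + 1) ^ k * N :=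
        (Nat.pow_le_pow_left N.le_succ k).trans (Nat.le_mul_of_pos_right _ hN)
      calc _ ≤ (N + 1) ^ k + (N + 1) ^ k * N := by omega
        _ = (N + 1) ^ (k + 1) := by ring

/-- If every component-preserving partition puts fewer than `k` components with sizes in `R` into
one of the clusters, there are few component-preserving partitions. -/
theorem card_preserving_le {C : Finset (Finset V)} (hC : IsPart C) {R : Finset ℕ} {k : ℕ}
    (h : ∀ p ∈ preserving C, ∃ y, (sideComps C p y R).card < k) :
    (preserving C).card ≤
      2 * ((Fintype.card V + 1) ^ k * 2 ^ (C.filter fun c => c.card ∉ R).card) := by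
  have h' : ∀ p, ∃ y, p ∈ preserving C → (sideComps C p y R).card < k := by
    intro p
    by_cases hp : p ∈ preserving C
    · obtain ⟨y, hy⟩ := h p hp
      exact ⟨y, fun _ => hy⟩
    · exact ⟨true, fun h => absurd h hp⟩
  choose y hy using h'
  set CR := C.filter fun c => c.card ∈ R
  set CN := C.filter fun c => c.card ∉ R
  have hcard : (Finset.univ ×ˢ (((Finset.range k).biUnion fun i => CR.powersetCard i) ×ˢ
      CN.powerset) : Finset (Bool × Finset (Finset V) × Finset (Finset V))).card ≤
      2 * ((Fintype.card V + 1) ^ k * 2 ^ CN.card) := by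
    rw [Finset.card_product, Finset.card_product, Finset.card_powerset, Finset.card_univ,
      Fintype.card_bool]
    gcongr
    refine Finset.card_biUnion_le.trans ?_
    simp only [Finset.card_powersetCard]
    exact sum_choose_le_pow ((Finset.card_filter_le _ _).trans hC.card_le) k
  -- Encode `p` by a cluster with few components of sizes in `R`, the set of those components, and
  -- the set of components of other sizes in cluster `true`. This determines the side of every
  -- component.
  refine le_trans (Finset.card_le_card_of_injOn
    (fun p => (y p, sideComps C p (y p) R, CN.filter fun c => ∀ v ∈ c, p v = true)) ?_ ?_) hcard
  · intro p hp
    simp only [Finset.coe_product, Set.mem_prod, Finset.mem_coe, Finset.mem_univ, true_and,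
      Finset.mem_biUnion, Finset.mem_range, Finset.mem_powersetCard, Finset.mem_powerset]
    refine ⟨⟨_, hy p hp, ?_, rfl⟩, Finset.filter_subset _ _⟩
    intro c hc
    obtain ⟨h1, -, h2⟩ := Finset.mem_filter.1 hc
    exact Finset.mem_filter.2 ⟨h1, h2⟩
  · intro p hp p' hp' heq
    simp only [Prod.mk.injEq] at heq
    obtain ⟨h1, h2, h3⟩ := heq
    rw [← h1] at h2
    have hp2 := (mem_preserving.1 hp).2
    have hp2' := (mem_preserving.1 hp').2
    funext v
    have hcC := hC.componentOf_mem v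
    have hvc := hC.mem_componentOf v
    set c := componentOf C v
    have key : ∀ b, ((∀ u ∈ c, p u = b) ↔ ∀ u ∈ c, p' u = b) → (p v = b ↔ p' v = b) := by
      intro b hb
      constructor
      · intro hv
        exact hb.1 (fun u hu => (hp2 c hcC u hu v hvc).trans hv) v hvc
      · intro hv
        exact hb.2 (fun u hu => (hp2' c hcC u hu v hvc).trans hv) v hvc
    have hbool : ∀ s t b : Bool, (s = b ↔ t = b) → s = t := by decide
    by_cases hcR : c.card ∈ R
    · refine hbool _ _ (y p) (key _ ?_)
      have := Finset.ext_iff.1 h2 c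
      simpa [sideComps, hcC, hcR] using this
    · refine hbool _ _ true (key _ ?_)
      have := Finset.ext_iff.1 h3 c
      simpa [CN, hcC, hcR] using this

end

/-! ### Expectations under discrete laws. -/

section Expectation

variable {α β : Type*}

/-- The expectation of an extended nonnegative function under a discrete law. -/
noncomputable def expect (p : PMF α) (φ : α → ℝ≥0∞) : ℝ≥0∞ := ∑' a, p a * φ a

theorem expect_pure (a : α) (φ : α → ℝ≥0∞) : expect (PMF.pure a) φ = φ a := by
  classical
  unfold expect
  rw [tsum_eq_single a]
  · simp
  · intro b hb
    simp [PMF.pure_apply, hb]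

theorem expect_bind (p : PMF α) (f : α → PMF β) (φ : β → ℝ≥0∞) :
    expect (p.bind f) φ = expect p fun a => expect (f a) φ := by
  unfold expect
  simp only [PMF.bind_apply, ← ENNReal.tsum_mul_right, ← ENNReal.tsum_mul_left]
  rw [ENNReal.tsum_comm]
  simp only [mul_assoc]

theorem expect_map (p : PMF α) (f : α → β) (φ : β → ℝ≥0∞) :
    expect (p.map f) φ = expect p fun a => φ (f a) := by
  rw [PMF.map, expect_bind]
  simp only [Function.comp, expect_pure]

theorem expect_const_add (p : PMF α) (c : ℝ≥0∞) (φ : α → ℝ≥0∞) :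
    (expect p fun a => c + φ a) = c + expect p φ := by
  unfold expect
  simp only [mul_add]
  rw [ENNReal.tsum_add, ENNReal.tsum_mul_right, PMF.tsum_coe, one_mul]

theorem expect_uniformOfFinset (s : Finset α) (hs : s.Nonempty) (φ : α → ℝ≥0∞) :
    expect (PMF.uniformOfFinset s hs) φ = (∑ a ∈ s, φ a) / s.card := by
  unfold expect
  rw [tsum_eq_sum (s := s) (fun a ha => by simp [PMF.uniformOfFinset_apply_of_notMem hs ha]),
    ENNReal.div_eq_inv_mul, Finset.mul_sum]
  exact Finset.sum_congr rfl fun a ha => by rw [PMF.uniformOfFinset_apply_of_mem hs ha]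

end Expectation

/-! ### Expected cost of the second stage. -/

section

variable {V : Type*} [Fintype V] [DecidableEq V]

/-- The expected cost of the algorithm on the requests `rs` when started in state `s`. -/
noncomputable def expectedCost (τ : TieBreaking V) (s : IcbState V) (rs : List (V × V)) : ℝ≥0∞ :=
  expect (icbCost τ s rs) fun c => (c : ℝ≥0∞)

theorem expectedCost_nil (τ : TieBreaking V) (s : IcbState V) : expectedCost τ s [] = 0 := by
  rw [expectedCost, icbCost, expect_pure, Nat.cast_zero]

theorem expectedCost_cons (τ : TieBreaking V) (s : IcbState V) (r : V × V) (rs : List (V × V)) :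
    expectedCost τ s (r :: rs) =
      expect (icbStep τ s r) fun s' => stepCost s r s' + expectedCost τ s' rs := by
  rw [expectedCost, icbCost, expect_bind]
  congr 1
  funext s'
  rw [expect_map]
  simp only [Nat.cast_add]
  rw [expect_const_add, expectedCost]

theorem stepCost_le (s : IcbState V) (r : V × V) (s' : IcbState V) :
    stepCost s r s' ≤ 1 + hammingDist s.part s'.part := by
  unfold stepCost
  split_ifs <;> omega

theorem stepCost_le_card (s : IcbState V) (r : V × V) (s' : IcbState V) :
    stepCost s r s' ≤ 1 + Fintype.card V :=
  (stepCost_le s r s').trans (Nat.add_le_add_left hammingDist_le_card_fintype 1)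

/-- The requests `l` are a legal continuation of an epoch with requests `h`. -/
def Continues (h l : List (V × V)) : Prop :=
  ∀ h' r l', l = h' ++ r :: l' →
    componentOf (components (h ++ h')) r.1 ≠ componentOf (components (h ++ h')) r.2 ∧
    (preserving (components (h ++ h'))).Nonempty

theorem IsEpoch.continues {rs : List (V × V)} (h : IsEpoch rs) : Continues [] rs := by
  rintro h' r l' rfl
  have := h h'.length (by simp)
  simpa using this

theorem Continues.tail {h l : List (V × V)} {r : V × V} (hc : Continues h (r :: l)) :
    Continues (h ++ [r]) l := by
  rintro h' r' l' rfl
  have := hc (r :: h') r' l' (by simp)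
  simpa using this

theorem Continues.head {h l : List (V × V)} {r : V × V} (hc : Continues h (r :: l)) :
    componentOf (components h) r.1 ≠ componentOf (components h) r.2 ∧
    (preserving (components h)).Nonempty := by
  have := hc [] r l rfl
  simpa using this

theorem Continues.eq_nil {h l : List (V × V)} (hc : Continues h l)
    (he : ¬ (preserving (components h)).Nonempty) : l = [] := by
  cases l with
  | nil => rfl
  | cons r l => exact absurd hc.head.2 he

theorem preserving_append_subset (h : List (V × V)) (r : V × V) :
    preserving (components (h ++ [r])) ⊆ preserving (components h) := by
  rw [components_append_singleton, merge_eq_join]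
  exact preserving_join_subset

theorem Continues.card_components {h l : List (V × V)} {r : V × V} (hc : Continues h (r :: l)) :
    (components (h ++ [r])).card + 1 = (components h).card := by
  rw [components_append_singleton, merge_eq_join]
  have hC := isPart_components h
  exact hC.card_join (hC.componentOf_mem _) (hC.componentOf_mem _) hc.head.1

/-- A request that leaves no preserving partition must be the last one, and the partition does not
move, so only the service cost remains. -/
theorem expectedCost_of_infeasible (τ : TieBreaking V) (s : IcbState V) {r : V × V}
    {rs : List (V × V)} (hc : Continues s.seen (r :: rs))
    (hP : ¬ (preserving (components (s.seen ++ [r]))).Nonempty) :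
    expectedCost τ s (r :: rs) ≤ 1 := by
  obtain rfl := hc.tail.eq_nil hP
  rw [expectedCost_cons, icbStep]
  simp only [hP, dite_false]
  rw [expect_pure, expectedCost_nil, add_zero]
  have := stepCost_le s r { s with seen := s.seen ++ [r] }
  simp only [hammingDist_self, add_zero] at this
  exact_mod_cast this

/-- `B` bounds the future cost averaged over the preserving partitions. If `p` survives, the step
costs at most 1; otherwise it costs at most 1 + n, and the new partition is uniform, so the average
bound applies to the rest. -/
theorem sum_expectedCost_cons_le (τ : TieBreaking V) {h : List (V × V)} {r : V × V}
    {rs : List (V × V)} {g : ℕ∞} {B : ℝ}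
    (hP : (preserving (components (h ++ [r]))).Nonempty) (hB : 0 ≤ B)
    (ih : ∑ p ∈ preserving (components (h ++ [r])), expectedCost τ ⟨h ++ [r], p, g, false⟩ rs ≤
      (preserving (components (h ++ [r]))).card * ENNReal.ofReal B) (p : V → Bool) :
    expectedCost τ ⟨h, p, g, false⟩ (r :: rs) ≤
      if p ∈ preserving (components (h ++ [r])) then
        1 + expectedCost τ ⟨h ++ [r], p, g, false⟩ rs
      else ENNReal.ofReal (1 + Fintype.card V + B) := by
  rw [expectedCost_cons, icbStep]
  simp only [hP, dite_true]
  by_cases hp : p ∈ preserving (components (h ++ [r]))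
  · simp only [hp, if_true, Bool.false_eq_true, if_false]
    rw [expect_pure]
    gcongr
    have := stepCost_le ⟨h, p, g, false⟩ r ⟨h ++ [r], p, g, false⟩
    simp only [hammingDist_self, add_zero] at this
    exact_mod_cast this
  · simp only [hp, if_false, Bool.false_eq_true]
    rw [expect_map]
    have h0 : ((preserving (components (h ++ [r]))).card : ℝ≥0∞) ≠ 0 := by
      simpa using hP.ne_empty
    calc _ ≤ expect (PMF.uniformOfFinset (preserving (components (h ++ [r]))) hP)
          (fun p' => ((1 + Fintype.card V : ℕ) : ℝ≥0∞) +
            expectedCost τ ⟨h ++ [r], p', g, false⟩ rs) := by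
          unfold expect
          refine ENNReal.tsum_le_tsum fun p' => ?_
          refine mul_le_mul' le_rfl (add_le_add_left ?_ _)
          exact_mod_cast stepCost_le_card (V := V) _ _ _
      _ ≤ _ := by
          rw [expect_const_add, expect_uniformOfFinset,
            ENNReal.ofReal_add (by positivity) hB]
          have : ENNReal.ofReal (1 + (Fintype.card V : ℝ)) = ((1 + Fintype.card V : ℕ) : ℝ≥0∞) := by
            rw [← ENNReal.ofReal_natCast]
            push_cast
            rfl
          rw [this]
          gcongr
          refine ENNReal.div_le_of_le_mul' ih

/-- In the second stage, the expected cost from a uniformly random component-preserving partition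
is logarithmic in the number of such partitions. -/
theorem sum_expectedCost_secondStage_le (τ : TieBreaking V) (g : ℕ∞) (rs : List (V × V)) :
    ∀ h : List (V × V), Continues h rs →
      ∑ p ∈ preserving (components h), expectedCost τ ⟨h, p, g, false⟩ rs ≤
        (preserving (components h)).card * ENNReal.ofReal
          (rs.length + Fintype.card V * Real.log (preserving (components h)).card) := by
  induction rs with
  | nil =>
    intro h _
    simp [expectedCost_nil]
  | cons r rs ih =>
    intro h hc
    have hlog : 0 ≤ Real.log (preserving (components h)).card := Real.log_natCast_nonneg _
    by_cases hP : (preserving (components (h ++ [r]))).Nonempty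
    · have ih' := ih (h ++ [r]) hc.tail
      set P := preserving (components h)
      set P' := preserving (components (h ++ [r])) with hP'
      have hlog' : 0 ≤ Real.log P'.card := Real.log_natCast_nonneg _
      obtain ⟨B, hBdef⟩ : ∃ B : ℝ, B = rs.length + Fintype.card V * Real.log P'.card := ⟨_, rfl⟩
      rw [← hBdef] at ih'
      have hB : 0 ≤ B := by rw [hBdef]; positivity
      have hsub : P' ⊆ P := preserving_append_subset h r
      have h1 : (0 : ℝ) < P'.card := by exact_mod_cast hP.card_pos
      have h2 : (P'.card : ℝ) ≤ P.card := by exact_mod_cast Finset.card_le_card hsub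
      -- A uniform element of `P` that survives is uniform in `P'`. Working with sums over all of
      -- `P` expresses this without conditioning: the terms in `P'` are exactly the sum in the
      -- induction hypothesis.
      calc ∑ p ∈ P, expectedCost τ ⟨h, p, g, false⟩ (r :: rs)
          ≤ ∑ p ∈ P, if p ∈ P' then 1 + expectedCost τ ⟨h ++ [r], p, g, false⟩ rs
            else ENNReal.ofReal (1 + Fintype.card V + B) :=
            Finset.sum_le_sum fun p _ => sum_expectedCost_cons_le τ hP hB ih' p
        _ = (P'.card + ∑ p ∈ P', expectedCost τ ⟨h ++ [r], p, g, false⟩ rs) +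
            (P \ P').card * ENNReal.ofReal (1 + Fintype.card V + B) := by
            rw [← Finset.sum_sdiff hsub, add_comm]
            congr 1
            · rw [Finset.sum_congr rfl (fun p hp => if_pos hp), Finset.sum_add_distrib]
              simp
            · rw [Finset.sum_congr rfl (fun p hp => if_neg (Finset.mem_sdiff.1 hp).2)]
              simp
        _ ≤ (P'.card + P'.card * ENNReal.ofReal B) +
            (P \ P').card * ENNReal.ofReal (1 + Fintype.card V + B) := by gcongr
        _ = ENNReal.ofReal (P'.card + P'.card * B +
              (P.card - P'.card) * (1 + Fintype.card V + B)) := by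
            rw [ENNReal.ofReal_add (by positivity) (mul_nonneg (by linarith) (by positivity)),
              ENNReal.ofReal_add (p := (P'.card : ℝ)) (by positivity) (by positivity),
              ENNReal.ofReal_mul (p := (P'.card : ℝ)) h1.le,
              ENNReal.ofReal_mul (by linarith), ENNReal.ofReal_natCast,
              Finset.card_sdiff_of_subset hsub, ← ENNReal.ofReal_natCast (P.card - P'.card),
              Nat.cast_sub (Finset.card_le_card hsub)]
        _ ≤ ENNReal.ofReal (P.card * ((r :: rs).length + Fintype.card V * Real.log P.card)) := by
            apply ENNReal.ofReal_le_ofReal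
            -- The inequality 1 - 1/x ≤ log x at x = |P|/|P'| bounds the resampling probability by
            -- the drop of log|P|.
            have h3 := Real.one_sub_inv_le_log_of_pos (div_pos (h1.trans_le h2) h1)
            rw [inv_div, Real.log_div (h1.trans_le h2).ne' h1.ne', sub_le_iff_le_add,
              ← sub_le_iff_le_add', le_div_iff₀ (h1.trans_le h2)] at h3
            have h4 : (P.card : ℝ) - P'.card ≤ P.card * (Real.log P.card - Real.log P'.card) := by
              linarith
            have h5 := mul_le_mul_of_nonneg_left h4 (Nat.cast_nonneg (α := ℝ) (Fintype.card V))
            simp only [List.length_cons, Nat.cast_add, Nat.cast_one]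
            rw [hBdef]
            linarith
        _ = _ := by
            rw [ENNReal.ofReal_mul (by positivity), ENNReal.ofReal_natCast]
    · calc _ ≤ ∑ p ∈ preserving (components h), (1 : ℝ≥0∞) :=
            Finset.sum_le_sum fun p _ => expectedCost_of_infeasible τ ⟨h, p, g, false⟩ hc hP
        _ = (preserving (components h)).card * 1 := by simp
        _ ≤ _ := by
            gcongr
            rw [ENNReal.one_le_ofReal]
            simp only [List.length_cons, Nat.cast_add, Nat.cast_one]
            have : (0 : ℝ) ≤ rs.length := Nat.cast_nonneg _
            have : 0 ≤ Fintype.card V * Real.log (preserving (components h)).card := by positivity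
            linarith

/-- The starting partition is arbitrary here. Until its first violation it pays at most 1 per
request; the resampling then costs at most n once, and from there on the partition is uniform. This
accounts for the additional summand n. -/
theorem expectedCost_secondStage_le (τ : TieBreaking V) (g : ℕ∞) (p : V → Bool)
    (rs : List (V × V)) :
    ∀ h : List (V × V), Continues h rs →
      expectedCost τ ⟨h, p, g, false⟩ rs ≤ ENNReal.ofReal (rs.length + Fintype.card V +
        Fintype.card V * Real.log (preserving (components h)).card) := by
  induction rs with
  | nil =>
    intro h _
    simp [expectedCost_nil]
  | cons r rs ih =>
    intro h hc
    have hlog : 0 ≤ Real.log (preserving (components h)).card := Real.log_natCast_nonneg _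
    by_cases hP : (preserving (components (h ++ [r]))).Nonempty
    · have hlog' : 0 ≤ Real.log (preserving (components (h ++ [r]))).card :=
        Real.log_natCast_nonneg _
      have hmono : Real.log (preserving (components (h ++ [r]))).card ≤
          Real.log (preserving (components h)).card :=
        Real.log_le_log (by exact_mod_cast hP.card_pos)
          (by exact_mod_cast Finset.card_le_card (preserving_append_subset h r))
      have hmul := mul_le_mul_of_nonneg_left hmono (Nat.cast_nonneg (α := ℝ) (Fintype.card V))
      refine (sum_expectedCost_cons_le τ hP (by positivity)
        (sum_expectedCost_secondStage_le τ g rs _ hc.tail) p).trans ?_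
      split_ifs with hp
      · refine (add_le_add_right (ih _ hc.tail) 1).trans ?_
        rw [← ENNReal.ofReal_one, ← ENNReal.ofReal_add zero_le_one (by positivity)]
        apply ENNReal.ofReal_le_ofReal
        simp only [List.length_cons, Nat.cast_add, Nat.cast_one]
        linarith
      · apply ENNReal.ofReal_le_ofReal
        simp only [List.length_cons, Nat.cast_add, Nat.cast_one]
        linarith
    · refine (expectedCost_of_infeasible τ ⟨h, p, g, false⟩ hc hP).trans ?_
      rw [ENNReal.one_le_ofReal]
      simp only [List.length_cons, Nat.cast_add, Nat.cast_one]
      have : (0 : ℝ) ≤ rs.length := Nat.cast_nonneg _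
      have : (0 : ℝ) ≤ Fintype.card V := Nat.cast_nonneg _
      have : 0 ≤ Fintype.card V * Real.log (preserving (components h)).card := by positivity
      linarith

end

/-! ### Weights of component sizes and changes of the gcd estimator. -/

section SizePotential

/-- The contribution of a component of size `i` to the potential: components with sizes outside of
`R` weigh `q`, and small components additionally weigh their size. -/
def sizeWeight (q : ℕ) (R : Finset ℕ) (i : ℕ) : ℕ :=
  (if i ∈ R then 0 else q) + (if i ≤ q then i else 0)

/-- The critical case is two sizes in R(g) whose sum leaves R(g). The sum is still a multiple of
`g`, so it must exceed `q`; the size terms `a + b > q` then vanish and pay for the new weight `q`.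
-/
theorem sizeWeight_add_le {q g a b : ℕ} (ha : 1 ≤ a) (hb : 1 ≤ b) :
    sizeWeight q (multiplesUpTo q g) (a + b) ≤
      sizeWeight q (multiplesUpTo q g) a + sizeWeight q (multiplesUpTo q g) b := by
  unfold sizeWeight
  by_cases hab : a ∈ multiplesUpTo q g ∧ b ∈ multiplesUpTo q g
  · have h1 := mem_multiplesUpTo_coe.1 hab.1
    have h2 := mem_multiplesUpTo_coe.1 hab.2
    rw [Finset.mem_Icc] at h1 h2
    by_cases hq : a + b ≤ q
    · have : a + b ∈ multiplesUpTo q g :=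
        mem_multiplesUpTo_coe.2 ⟨Finset.mem_Icc.2 ⟨by omega, hq⟩, dvd_add h1.2 h2.2⟩
      simp only [this, hab.1, hab.2, if_true, hq, h1.1.2, h2.1.2]
      omega
    · simp only [hab.1, hab.2, hq, h1.1.2, h2.1.2, if_true, if_false]
      split_ifs <;> omega
  · rw [not_and_or] at hab
    split_ifs <;> first | omega | tauto

/-- Two penalties `q` are replaced by at most one, and the size terms do not grow. -/
theorem sizeWeight_add_add_le {q a b : ℕ} {R : Finset ℕ} (ha : a ∉ R) (hb : b ∉ R) :
    sizeWeight q R (a + b) + q ≤ sizeWeight q R a + sizeWeight q R b := by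
  unfold sizeWeight
  simp only [ha, hb, if_false]
  split_ifs <;> omega

theorem gcd_eq_of_gcdTop_eq {A : Finset ℕ} {m : ℕ} (h : gcdTop A = m) : A.gcd id = m := by
  unfold gcdTop at h
  split_ifs at h with h0
  · exact absurd h (ENat.top_ne_natCast m)
  · exact_mod_cast h

theorem multiplesUpTo_top (q : ℕ) : multiplesUpTo q ⊤ = ∅ := by
  ext i
  simp only [multiplesUpTo, Finset.mem_filter, Finset.mem_Icc, Finset.notMem_empty, iff_false,
    not_and]
  rintro hi ⟨l, hl⟩
  rcases Nat.eq_zero_or_pos l with rfl | hl0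
  · simp at hl
    omega
  · rw [ENat.mul_top (by exact_mod_cast hl0.ne')] at hl
    exact ENat.natCast_ne_top i hl

theorem exists_gcdTop_eq {A : Finset ℕ} {q : ℕ} (hA : A ⊆ Finset.Icc 1 q) (h : gcdTop A ≠ ⊤) :
    ∃ m : ℕ, gcdTop A = m ∧ 1 ≤ m ∧ m ≤ q := by
  unfold gcdTop at h ⊢
  split_ifs at h ⊢ with h0
  · exact absurd rfl h
  · obtain ⟨i, hi⟩ := Finset.nonempty_iff_ne_empty.2 h0
    have hi' := Finset.mem_Icc.1 (hA hi)
    have hdvd : A.gcd id ∣ i := Finset.gcd_dvd hi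
    exact ⟨_, rfl, Nat.pos_of_dvd_of_pos hdvd (by omega), (Nat.le_of_dvd (by omega) hdvd).trans hi'.2⟩

theorem mem_multiplesUpTo_gcdTop {A : Finset ℕ} {q i : ℕ} (hA : A ⊆ Finset.Icc 1 q) (hi : i ∈ A) :
    i ∈ multiplesUpTo q (gcdTop A) := by
  have h0 : A ≠ ∅ := Finset.nonempty_iff_ne_empty.1 ⟨i, hi⟩
  rw [gcdTop, if_neg h0]
  exact mem_multiplesUpTo_coe.2 ⟨hA hi, Finset.gcd_dvd hi⟩

theorem multiplesUpTo_gcdTop_subset {q g : ℕ} {A : Finset ℕ} (hA : A ⊆ multiplesUpTo q g) :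
    multiplesUpTo q (gcdTop A) ⊆ multiplesUpTo q g := by
  by_cases h : gcdTop A = ⊤
  · simp [h, multiplesUpTo_top]
  · obtain ⟨m, hm, -, -⟩ := exists_gcdTop_eq (hA.trans (multiplesUpTo_subset q g)) h
    have hgm : g ∣ m := by
      rw [← gcd_eq_of_gcdTop_eq hm]
      exact Finset.dvd_gcd fun i hi => (mem_multiplesUpTo_coe.1 (hA hi)).2
    rw [hm]
    intro i hi
    rw [mem_multiplesUpTo_coe] at hi ⊢
    exact ⟨hi.1, hgm.trans hi.2⟩

/-- The old `g` is lost: if it were a multiple of the new gcd, which is itself a multiple of `g`,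
the two would coincide. Thus a change of the estimator uses up at least one element of R(g). -/
theorem card_multiplesUpTo_gcdTop_lt {q g : ℕ} (hg : 1 ≤ g) (hgq : g ≤ q) {A : Finset ℕ}
    (hA : A ⊆ multiplesUpTo q g) (hne : gcdTop A ≠ g) :
    (multiplesUpTo q (gcdTop A)).card < (multiplesUpTo q g).card := by
  refine Finset.card_lt_card ((Finset.ssubset_iff_of_subset (multiplesUpTo_gcdTop_subset hA)).2
    ⟨g, mem_multiplesUpTo_coe.2 ⟨Finset.mem_Icc.2 ⟨hg, hgq⟩, dvd_rfl⟩, fun hmem => ?_⟩)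
  by_cases h : gcdTop A = ⊤
  · rw [h, multiplesUpTo_top] at hmem
    exact absurd hmem (Finset.notMem_empty _)
  · obtain ⟨m, hm, -, -⟩ := exists_gcdTop_eq (hA.trans (multiplesUpTo_subset q g)) h
    have hgm : g ∣ m := by
      rw [← gcd_eq_of_gcdTop_eq hm]
      exact Finset.dvd_gcd fun i hi => (mem_multiplesUpTo_coe.1 (hA hi)).2
    rw [hm] at hmem
    have := (mem_multiplesUpTo_coe.1 hmem).2
    exact hne (by rw [hm, Nat.dvd_antisymm this hgm])

end SizePotential

/-! ### Amortized analysis of the first stage. -/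

section FirstStage

variable {V : Type*} [Fintype V] [DecidableEq V]

/-- The part of the potential that bounds the number of expensive steps. -/
noncomputable def sizePotential (C : Finset (Finset V)) (g : ℕ∞) : ℕ :=
  ∑ c ∈ C, sizeWeight (qParam (Fintype.card V)) (multiplesUpTo (qParam (Fintype.card V)) g) c.card +
    (qParam (Fintype.card V) ^ 2 * wParam (Fintype.card V) + qParam (Fintype.card V)) *
      (multiplesUpTo (qParam (Fintype.card V)) g).card

theorem sum_sizeWeight_join {C : Finset (Finset V)} (hC : IsPart C) {x y : Finset V} (hx : x ∈ C)
    (hy : y ∈ C) (hxy : x ≠ y) (q : ℕ) (R : Finset ℕ) :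
    ∑ c ∈ join C x y, sizeWeight q R c.card + (sizeWeight q R x.card + sizeWeight q R y.card) =
      ∑ c ∈ C, sizeWeight q R c.card + sizeWeight q R (x.card + y.card) := by
  rw [← Finset.card_union_of_disjoint (hC.disjoint hx hy hxy)]
  exact hC.sum_join hx hy hxy fun c => sizeWeight q R c.card

theorem sum_sizeWeight_join_le {C : Finset (Finset V)} (hC : IsPart C) {x y : Finset V}
    (hx : x ∈ C) (hy : y ∈ C) (hxy : x ≠ y) (q g : ℕ) :
    ∑ c ∈ join C x y, sizeWeight q (multiplesUpTo q g) c.card ≤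
      ∑ c ∈ C, sizeWeight q (multiplesUpTo q g) c.card := by
  have h1 := sum_sizeWeight_join hC hx hy hxy q (multiplesUpTo q g)
  have h2 := sizeWeight_add_le (q := q) (g := g) (hC.nonempty x hx).card_pos
    (hC.nonempty y hy).card_pos
  omega

theorem sizePotential_join_le {C : Finset (Finset V)} (hC : IsPart C) {x y : Finset V} (hx : x ∈ C)
    (hy : y ∈ C) (hxy : x ≠ y) (g : ℕ) : sizePotential (join C x y) g ≤ sizePotential C g := by
  unfold sizePotential
  gcongr ?_ + _
  exact sum_sizeWeight_join_le hC hx hy hxy _ g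

theorem sizePotential_join_add_le {C : Finset (Finset V)} (hC : IsPart C) {x y : Finset V}
    (hx : x ∈ C) (hy : y ∈ C) (hxy : x ≠ y) {g : ℕ∞}
    (hxR : x.card ∉ multiplesUpTo (qParam (Fintype.card V)) g)
    (hyR : y.card ∉ multiplesUpTo (qParam (Fintype.card V)) g) :
    sizePotential (join C x y) g + qParam (Fintype.card V) ≤ sizePotential C g := by
  unfold sizePotential
  have h1 := sum_sizeWeight_join hC hx hy hxy (qParam (Fintype.card V))
    (multiplesUpTo (qParam (Fintype.card V)) g)
  have h2 := sizeWeight_add_add_le (q := qParam (Fintype.card V)) hxR hyR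
  omega

/-- At most `q` sizes leave R(g), and each is unpopular, so fewer than w components have it. Their
new penalties total at most q²w. The set of multiples loses an element, worth q²w + q, which covers
this and leaves `q` over. -/
theorem sizePotential_of_gcd_ne {C : Finset (Finset V)} (hC : IsPart C) {x y : Finset V}
    (hx : x ∈ C) (hy : y ∈ C) (hxy : x ≠ y) {g : ℕ} (hg : 1 ≤ g)
    (hgq : g ≤ qParam (Fintype.card V))
    (hne : gcdTop (multiplesUpTo (qParam (Fintype.card V)) g ∩ popular (join C x y)) ≠ g) :
    sizePotential (join C x y)
        (gcdTop (multiplesUpTo (qParam (Fintype.card V)) g ∩ popular (join C x y))) +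
      qParam (Fintype.card V) ≤ sizePotential C g := by
  set q := qParam (Fintype.card V) with hq
  set A := multiplesUpTo q g ∩ popular (join C x y) with hA
  have hAR : A ⊆ multiplesUpTo q g := Finset.inter_subset_left
  have hAq : A ⊆ Finset.Icc 1 q := hAR.trans (multiplesUpTo_subset q g)
  have hlt := card_multiplesUpTo_gcdTop_lt hg hgq hAR hne
  set R := multiplesUpTo q g
  set R' := multiplesUpTo q (gcdTop A)
  have hw : ∀ c ∈ join C x y, sizeWeight q R' c.card ≤
      sizeWeight q R c.card + if c.card ∈ R \ R' then q else 0 := by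
    intro c _
    unfold sizeWeight
    simp only [Finset.mem_sdiff]
    split_ifs <;> first | omega | tauto
  have hcount : ((join C x y).filter fun c => c.card ∈ R \ R').card ≤
      q * wParam (Fintype.card V) := by
    have hmaps : ∀ c ∈ (join C x y).filter (fun c => c.card ∈ R \ R'), c.card ∈ R \ R' :=
      fun c hc => (Finset.mem_filter.1 hc).2
    rw [Finset.card_eq_sum_card_fiberwise hmaps]
    calc _ ≤ ∑ i ∈ R \ R', wParam (Fintype.card V) := by
          refine Finset.sum_le_sum fun i hi => ?_
          obtain ⟨hi1, hi2⟩ := Finset.mem_sdiff.1 hi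
          -- A popular size in the old R(g) is divisible by the new gcd and would have stayed.
          have hnp : i ∉ popular (join C x y) := fun hp =>
            hi2 (mem_multiplesUpTo_gcdTop hAq (Finset.mem_inter.2 ⟨hi1, hp⟩))
          have hcnt : cnt (join C x y) i < wParam (Fintype.card V) := by
            by_contra hcon
            exact hnp (Finset.mem_filter.2 ⟨multiplesUpTo_subset q g hi1, by omega⟩)
          refine le_trans (Finset.card_le_card fun c hc => ?_) hcnt.le
          obtain ⟨hc1, hc2⟩ := Finset.mem_filter.1 hc
          exact Finset.mem_filter.2 ⟨(Finset.mem_filter.1 hc1).1, hc2⟩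
      _ = (R \ R').card * wParam (Fintype.card V) := by rw [Finset.sum_const, smul_eq_mul]
      _ ≤ _ := by
          gcongr
          simpa using Finset.card_le_card
            ((Finset.sdiff_subset (s := R) (t := R')).trans (multiplesUpTo_subset q g))
  have hsum : ∑ c ∈ join C x y, sizeWeight q R' c.card ≤
      ∑ c ∈ C, sizeWeight q R c.card + q ^ 2 * wParam (Fintype.card V) := by
    calc _ ≤ ∑ c ∈ join C x y, (sizeWeight q R c.card + if c.card ∈ R \ R' then q else 0) :=
          Finset.sum_le_sum hw
      _ = ∑ c ∈ join C x y, sizeWeight q R c.card +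
          ((join C x y).filter fun c => c.card ∈ R \ R').card * q := by
          rw [Finset.sum_add_distrib, ← Finset.sum_filter, Finset.sum_const, smul_eq_mul]
      _ ≤ ∑ c ∈ C, sizeWeight q R c.card + q * wParam (Fintype.card V) * q := by
          gcongr ?_ + ?_ * q
          exact sum_sizeWeight_join_le hC hx hy hxy q g
      _ = _ := by ring
  unfold sizePotential
  have hmul := Nat.mul_le_mul_left (q ^ 2 * wParam (Fintype.card V) + q) (Nat.succ_le_of_lt hlt)
  rw [Nat.succ_eq_add_one, mul_add, mul_one] at hmul
  change ∑ c ∈ join C x y, sizeWeight q R' c.card + (q ^ 2 * wParam (Fintype.card V) + q) * R'.card +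
    q ≤ ∑ c ∈ C, sizeWeight q R c.card + (q ^ 2 * wParam (Fintype.card V) + q) * R.card
  omega

/-- The number of components that are missing to a well-balanced partition. -/
noncomputable def deficit (C : Finset (Finset V)) (p : V → Bool) (g : ℕ∞) : ℕ :=
  ∑ b : Bool, (2 * dParam (Fintype.card V) -
    (sideComps C p b (multiplesUpTo (qParam (Fintype.card V)) g)).card)

theorem mem_properPartitions {g : ℕ∞} {l : ℕ} {C : Finset (Finset V)} {p : V → Bool} :
    p ∈ properPartitions g l C ↔ p ∈ preserving C ∧
      ∀ b, l ≤ (sideComps C p b (multiplesUpTo (qParam (Fintype.card V)) g)).card := by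
  simp only [properPartitions, Finset.mem_filter, sum_cntSide]

theorem properPartitions_mono (g : ℕ∞) {l l' : ℕ} (h : l ≤ l') (C : Finset (Finset V)) :
    properPartitions g l' C ⊆ properPartitions g l C := by
  intro p hp
  rw [mem_properPartitions] at hp ⊢
  exact ⟨hp.1, fun b => h.trans (hp.2 b)⟩

/-- The amortized cost of a step in which a nearby component-preserving partition exists. -/
noncomputable def cheapCost (n : ℕ) : ℝ :=
  1 + 4 * (qParam n : ℝ) ^ 4 + 2 * (4 * (qParam n : ℝ) ^ 4 + 2) * (n / dParam n)

/-- The potential of the first stage. -/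
noncomputable def potential (C : Finset (Finset V)) (p : V → Bool) (g : ℕ∞) : ℝ :=
  (5 * Fintype.card V + 1) / qParam (Fintype.card V) * sizePotential C g +
    Fintype.card V / dParam (Fintype.card V) * deficit C p g + cheapCost (Fintype.card V) * C.card

theorem cheapCost_nonneg (n : ℕ) : 0 ≤ cheapCost n := by unfold cheapCost; positivity

theorem potential_nonneg (C : Finset (Finset V)) (p : V → Bool) (g : ℕ∞) :
    0 ≤ potential C p g := by
  have := cheapCost_nonneg (Fintype.card V)
  unfold potential
  positivity

theorem deficit_le (C : Finset (Finset V)) (p : V → Bool) (g : ℕ∞) :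
    deficit C p g ≤ 4 * dParam (Fintype.card V) := by
  unfold deficit
  rw [Fintype.sum_bool]
  omega

theorem sizePotential_gcdTop_le {C : Finset (Finset V)} (hC : IsPart C) {x y : Finset V}
    (hx : x ∈ C) (hy : y ∈ C) (hxy : x ≠ y) {g : ℕ} (hg : 1 ≤ g)
    (hgq : g ≤ qParam (Fintype.card V)) :
    sizePotential (join C x y)
        (gcdTop (multiplesUpTo (qParam (Fintype.card V)) g ∩ popular (join C x y))) ≤
      sizePotential C g := by
  by_cases h : gcdTop (multiplesUpTo (qParam (Fintype.card V)) g ∩ popular (join C x y)) = g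
  · rw [h]
    exact sizePotential_join_le hC hx hy hxy g
  · exact le_of_add_le_left (sizePotential_of_gcd_ne hC hx hy hxy hg hgq h)

/-- The drop by `q` releases 5n + 1: 1 for the request, n for an arbitrary move, and 4n because the
deficit term can never exceed (n/d) · 4d. -/
theorem potential_step_of_sizePotential_lt {C : Finset (Finset V)} (hC : IsPart C)
    {x y : Finset V} (hx : x ∈ C) (hy : y ∈ C) (hxy : x ≠ y)
    (hq : 1 ≤ qParam (Fintype.card V)) (hd : 1 ≤ dParam (Fintype.card V)) {p p' : V → Bool}
    {g g' : ℕ∞}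
    (h : sizePotential (join C x y) g' + qParam (Fintype.card V) ≤ sizePotential C g) :
    1 + (hammingDist p p' : ℝ) + potential (join C x y) p' g' ≤ potential C p g := by
  unfold potential
  have hq' : (0 : ℝ) < qParam (Fintype.card V) := by exact_mod_cast hq
  have hd' : (0 : ℝ) < dParam (Fintype.card V) := by exact_mod_cast hd
  have hh : (hammingDist p p' : ℝ) ≤ Fintype.card V := by exact_mod_cast hammingDist_le_card_fintype
  have hD : (deficit (join C x y) p' g' : ℝ) ≤ 4 * dParam (Fintype.card V) := by
    exact_mod_cast deficit_le (join C x y) p' g'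
  have hcard : ((join C x y).card : ℝ) ≤ C.card := by
    have := hC.card_join hx hy hxy
    exact_mod_cast (by omega : (join C x y).card ≤ C.card)
  have h' : (sizePotential (join C x y) g' : ℝ) + qParam (Fintype.card V) ≤ sizePotential C g := by
    exact_mod_cast h
  have e1 := mul_le_mul_of_nonneg_left h'
    (by positivity : (0 : ℝ) ≤ (5 * Fintype.card V + 1) / qParam (Fintype.card V))
  rw [mul_add, div_mul_cancel₀ _ hq'.ne'] at e1
  have e2 := mul_le_mul_of_nonneg_left hD
    (by positivity : (0 : ℝ) ≤ Fintype.card V / dParam (Fintype.card V))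
  have e3 : (Fintype.card V / dParam (Fintype.card V) : ℝ) * (4 * dParam (Fintype.card V)) =
      4 * Fintype.card V := by field_simp
  have e4 := mul_le_mul_of_nonneg_left hcard (cheapCost_nonneg (Fintype.card V))
  have e5 : (0 : ℝ) ≤ Fintype.card V / dParam (Fintype.card V) * deficit C p g := by positivity
  linarith

/-- The vanished component releases `cheapCost`, which pays for the request, the short move, and the
growth of the deficit on both sides. If `pc` is rejected, some side has fewer than d relevant
components, so its deficit is at least d; resetting the deficit to 0 releases the n needed for the
long move, up to the growth already paid for. -/
theorem potential_step_of_near {C : Finset (Finset V)} (hC : IsPart C)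
    {x y : Finset V} (hx : x ∈ C) (hy : y ∈ C) (hxy : x ≠ y)
    (hd : 1 ≤ dParam (Fintype.card V)) {p pc p' : V → Bool} {g : ℕ}
    (hnear : hammingDist p pc ≤ 4 * qParam (Fintype.card V) ^ 4)
    (hpc : pc ∈ preserving (join C x y))
    (hp' : pc ∈ properPartitions g (dParam (Fintype.card V)) (join C x y) ∧ p' = pc ∨
      pc ∉ properPartitions g (dParam (Fintype.card V)) (join C x y) ∧
        p' ∈ properPartitions g (2 * dParam (Fintype.card V)) (join C x y)) :
    1 + (hammingDist p p' : ℝ) + potential (join C x y) p' g ≤ potential C p g := by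
  have hd' : (0 : ℝ) < dParam (Fintype.card V) := by exact_mod_cast hd
  have hdef : deficit (join C x y) pc g ≤
      deficit C p g + 2 * (4 * qParam (Fintype.card V) ^ 4 + 2) := by
    unfold deficit
    rw [Fintype.sum_bool, Fintype.sum_bool]
    have h1 := hC.card_sideComps_le (x := x) (y := y) p pc true
      (multiplesUpTo (qParam (Fintype.card V)) g)
    have h2 := hC.card_sideComps_le (x := x) (y := y) p pc false
      (multiplesUpTo (qParam (Fintype.card V)) g)
    omega
  have hpot := sizePotential_join_le hC hx hy hxy g
  have hcard : ((join C x y).card : ℝ) + 1 = C.card := by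
    exact_mod_cast hC.card_join hx hy hxy
  have e1 := mul_le_mul_of_nonneg_left (Nat.cast_le (α := ℝ).2 hpot)
    (by positivity : (0 : ℝ) ≤ (5 * Fintype.card V + 1) / qParam (Fintype.card V))
  have hκ : (0 : ℝ) ≤ Fintype.card V / dParam (Fintype.card V) := by positivity
  unfold potential
  rw [← hcard, mul_add, mul_one]
  rcases hp' with ⟨-, rfl⟩ | ⟨hnot, hmem⟩
  · have e2 := mul_le_mul_of_nonneg_left (Nat.cast_le (α := ℝ).2 hdef) hκ
    have e3 : (hammingDist p p' : ℝ) ≤ 4 * (qParam (Fintype.card V) : ℝ) ^ 4 := by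
      exact_mod_cast hnear
    push_cast at e2
    have e4 : cheapCost (Fintype.card V) = 1 + 4 * (qParam (Fintype.card V) : ℝ) ^ 4 +
      2 * (4 * (qParam (Fintype.card V) : ℝ) ^ 4 + 2) *
        (Fintype.card V / dParam (Fintype.card V)) := rfl
    linarith
  · have hzero : deficit (join C x y) p' g = 0 := by
      unfold deficit
      refine Finset.sum_eq_zero fun b _ => Nat.sub_eq_zero_of_le ?_
      exact (mem_properPartitions.1 hmem).2 b
    have hlarge : dParam (Fintype.card V) ≤
        deficit C p g + 2 * (4 * qParam (Fintype.card V) ^ 4 + 2) := by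
      refine le_trans ?_ hdef
      rw [mem_properPartitions, not_and] at hnot
      obtain ⟨b, hb⟩ := not_forall.1 (hnot hpc)
      unfold deficit
      refine le_trans ?_ (Finset.single_le_sum (fun i _ => Nat.zero_le _) (Finset.mem_univ b))
      omega
    have hh : (hammingDist p p' : ℝ) ≤ Fintype.card V := by
      exact_mod_cast hammingDist_le_card_fintype
    have e2 := mul_le_mul_of_nonneg_left (Nat.cast_le (α := ℝ).2 hlarge) hκ
    push_cast at e2
    rw [div_mul_cancel₀ _ hd'.ne'] at e2
    have e4 : cheapCost (Fintype.card V) = 1 + 4 * (qParam (Fintype.card V) : ℝ) ^ 4 +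
      2 * (4 * (qParam (Fintype.card V) : ℝ) ^ 4 + 2) *
        (Fintype.card V / dParam (Fintype.card V)) := rfl
    have e5 : (0 : ℝ) ≤ 4 * (qParam (Fintype.card V) : ℝ) ^ 4 := by positivity
    rw [hzero, Nat.cast_zero, mul_zero]
    linarith

/-- Amortized analysis of a step of the first stage. -/
theorem potential_step {C : Finset (Finset V)} (hC : IsPart C) {x y : Finset V} (hx : x ∈ C)
    (hy : y ∈ C) (hxy : x ≠ y) {g : ℕ} (hg : 1 ≤ g) (hgq : g ≤ qParam (Fintype.card V))
    (hd : qParam (Fintype.card V) * (3 * qParam (Fintype.card V) ^ 4 + 2) <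
      dParam (Fintype.card V)) {p pc p' : V → Bool} {g' : ℕ∞}
    (hp : p ∈ properPartitions g (dParam (Fintype.card V)) C)
    (hg' : g' = gcdTop (multiplesUpTo (qParam (Fintype.card V)) g ∩ popular (join C x y)))
    (hpc : pc ∈ closest p (join C x y))
    (hp' : pc ∈ properPartitions g' (dParam (Fintype.card V)) (join C x y) ∧ p' = pc ∨
      pc ∉ properPartitions g' (dParam (Fintype.card V)) (join C x y) ∧
        p' ∈ properPartitions g' (2 * dParam (Fintype.card V)) (join C x y)) :
    1 + (hammingDist p p' : ℝ) + potential (join C x y) p' g' ≤ potential C p g := by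
  have hq1 : 1 ≤ qParam (Fintype.card V) := hg.trans hgq
  have hd1 : 1 ≤ dParam (Fintype.card V) := by omega
  by_cases hgg : g' = g
  -- With both sizes outside R(g) no nearby partition is guaranteed, but the merge removes a penalty
  -- `q`.
  · by_cases hR : x.card ∉ multiplesUpTo (qParam (Fintype.card V)) g ∧
        y.card ∉ multiplesUpTo (qParam (Fintype.card V)) g
    · refine potential_step_of_sizePotential_lt hC hx hy hxy hq1 hd1 ?_
      rw [hgg]
      exact sizePotential_join_add_le hC hx hy hxy hR.1 hR.2
    · rw [hgg] at hg' hp' ⊢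
      rw [mem_properPartitions] at hp
      have hJ : multiplesUpTo (qParam (Fintype.card V)) g ∩ popular (join C x y) ⊆
          Finset.Icc 1 (qParam (Fintype.card V)) :=
        Finset.inter_subset_left.trans (multiplesUpTo_subset _ _)
      have hgcd := gcd_eq_of_gcdTop_eq hg'.symm
      have hpop : ∀ j ∈ multiplesUpTo (qParam (Fintype.card V)) g ∩ popular (join C x y),
          4 * qParam (Fintype.card V) ^ 4 + 2 ≤ cnt (join C x y) j := fun j hj =>
        (Finset.mem_filter.1 (Finset.mem_inter.1 hj).2).2
      have hside := fun b => hd.trans_le (hp.2 b)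
      have hex : ∃ p' ∈ preserving (join C x y),
          hammingDist p p' ≤ 4 * qParam (Fintype.card V) ^ 4 := by
        rw [not_and_or, not_not, not_not] at hR
        rcases hR with hR | hR
        · exact exists_near_preserving hC hx hy hp.1 hJ hgcd hpop hside hR
        · rw [join_comm] at hJ hgcd hpop ⊢
          exact exists_near_preserving hC hy hx hp.1 hJ hgcd hpop hside hR
      obtain ⟨p₁, hp₁, hdist⟩ := hex
      obtain ⟨hpc1, hpc2⟩ := Finset.mem_filter.1 hpc
      exact potential_step_of_near hC hx hy hxy hd1 ((hpc2 p₁ hp₁).trans hdist) hpc1 hp'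
  · refine potential_step_of_sizePotential_lt hC hx hy hxy hq1 hd1 ?_
    subst hg'
    exact sizePotential_of_gcd_ne hC hx hy hxy hg hgq hgg

/-- Each component with size outside R(g) weighs at least `q`, so there are at most `P / q` of them.
-/
theorem card_preserving_le_of_properPartitions_eq_empty {C : Finset (Finset V)} (hC : IsPart C)
    {g : ℕ∞} {k : ℕ} (h : properPartitions g k C = ∅) (hq : 1 ≤ qParam (Fintype.card V))
    {P : ℕ} (hP : sizePotential C g ≤ P) :
    (preserving C).card ≤
      2 * ((Fintype.card V + 1) ^ k * 2 ^ (P / qParam (Fintype.card V))) := by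
  refine (card_preserving_le hC (R := multiplesUpTo (qParam (Fintype.card V)) g) (k := k)
    fun p hp => ?_).trans ?_
  · by_contra hcon
    push Not at hcon
    have : p ∈ properPartitions g k C := mem_properPartitions.2 ⟨hp, hcon⟩
    rw [h] at this
    exact absurd this (Finset.notMem_empty p)
  · gcongr
    · norm_num
    rw [Nat.le_div_iff_mul_le hq]
    refine le_trans ?_ hP
    unfold sizePotential
    refine le_trans ?_ (Nat.le_add_right _ _)
    calc _ = ∑ c ∈ C.filter (fun c => c.card ∉ multiplesUpTo (qParam (Fintype.card V)) g),
          qParam (Fintype.card V) := by rw [Finset.sum_const, smul_eq_mul]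
      _ ≤ _ := by
        rw [Finset.sum_filter]
        refine Finset.sum_le_sum fun c _ => ?_
        unfold sizeWeight
        split_ifs <;> omega

theorem Continues.length_le (rs : List (V × V)) :
    ∀ h : List (V × V), Continues h rs → rs.length ≤ (components h).card := by
  induction rs with
  | nil => simp
  | cons r rs ih =>
    intro h hc
    have h1 := ih _ hc.tail
    have h2 := hc.card_components
    simp only [List.length_cons]
    omega

/-- A bound on the cost of the second stage and the step before it, in terms of the number of
elements and a bound on `sizePotential`. -/
noncomputable def secondStageBound (n P : ℕ) : ℝ :=
  1 + 2 * n + n * Real.log ((2 * ((n + 1) ^ (2 * dParam n) * 2 ^ (P / qParam n)) : ℕ) : ℝ)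

/-- The potential absorbs the steps of the first stage, and `secondStageBound` is spent once, at its
end. `P` can stay fixed throughout because `sizePotential` never increases. The invariant that `p`
keeps `d` relevant components in each cluster is what makes nearby partitions available. -/
theorem expectedCost_firstStage_le (τ : TieBreaking V) {P : ℕ}
    (hd : qParam (Fintype.card V) * (3 * qParam (Fintype.card V) ^ 4 + 2) <
      dParam (Fintype.card V)) (rs : List (V × V)) :
    ∀ (h : List (V × V)) (p : V → Bool) (g : ℕ), Continues h rs → 1 ≤ g →
      g ≤ qParam (Fintype.card V) →
      p ∈ properPartitions g (dParam (Fintype.card V)) (components h) →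
      sizePotential (components h) g ≤ P →
      expectedCost τ ⟨h, p, g, true⟩ rs ≤ ENNReal.ofReal (potential (components h) p g +
        secondStageBound (Fintype.card V) P) := by
  have hS : 1 ≤ secondStageBound (Fintype.card V) P := by
    unfold secondStageBound
    have := Real.log_natCast_nonneg (2 * ((Fintype.card V + 1) ^ (2 * dParam (Fintype.card V)) *
      2 ^ (P / qParam (Fintype.card V))))
    have : 0 ≤ Fintype.card V * Real.log ((2 * ((Fintype.card V + 1) ^
      (2 * dParam (Fintype.card V)) * 2 ^ (P / qParam (Fintype.card V))) : ℕ) : ℝ) := by positivity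
    have : (0 : ℝ) ≤ Fintype.card V := Nat.cast_nonneg _
    linarith
  induction rs with
  | nil =>
    intro h p g _ _ _ _ _
    simp [expectedCost_nil]
  | cons r rs ih =>
    intro h p g hc hg hgq hp hP
    have hpot := potential_nonneg (components h) p g
    by_cases hPres : (preserving (components (h ++ [r]))).Nonempty
    swap
    · refine (expectedCost_of_infeasible τ ⟨h, p, g, true⟩ hc hPres).trans ?_
      rw [ENNReal.one_le_ofReal]
      linarith
    have hC := isPart_components h
    have hx := hC.componentOf_mem r.1
    have hy := hC.componentOf_mem r.2
    have hxy := hc.head.1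
    have hjoin : components (h ++ [r]) =
        join (components h) (componentOf (components h) r.1) (componentOf (components h) r.2) := by
      rw [components_append_singleton, merge_eq_join]
    rw [expectedCost_cons, icbStep]
    simp only [hPres, dite_true, if_true]
    rw [expect_pure]
    obtain ⟨g', hg'⟩ : ∃ g', g' = gcdTop (multiplesUpTo (qParam (Fintype.card V)) g ∩
      popular (components (h ++ [r]))) := ⟨_, rfl⟩
    have hPsi : sizePotential (components (h ++ [r])) g' ≤ P := by
      refine le_trans ?_ hP
      rw [hg', hjoin]
      exact sizePotential_gcdTop_le hC hx hy hxy hg hgq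
    have hq1 : 1 ≤ qParam (Fintype.card V) := hg.trans hgq
    by_cases hempty : properPartitions g' (2 * dParam (Fintype.card V)) (components (h ++ [r])) = ∅
    · have hstep : firstStageStep τ ⟨h, p, g, true⟩ (h ++ [r]) = ⟨h ++ [r], p, g', false⟩ := by
        simp only [firstStageStep, ← hg', hempty, if_true]
      rw [hstep]
      have h1 : (stepCost ⟨h, p, g, true⟩ r ⟨h ++ [r], p, g', false⟩ : ℝ≥0∞) ≤
          ENNReal.ofReal 1 := by
        have := stepCost_le ⟨h, p, g, true⟩ r ⟨h ++ [r], p, g', false⟩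
        simp only [hammingDist_self, add_zero] at this
        rw [ENNReal.ofReal_one]
        exact_mod_cast this
      have hlen : (rs.length : ℝ) ≤ Fintype.card V := by
        exact_mod_cast (Continues.length_le rs _ hc.tail).trans (isPart_components _).card_le
      have hlog : Real.log (preserving (components (h ++ [r]))).card ≤
          Real.log ((2 * ((Fintype.card V + 1) ^ (2 * dParam (Fintype.card V)) *
            2 ^ (P / qParam (Fintype.card V))) : ℕ) : ℝ) := by
        refine Real.log_le_log (by exact_mod_cast hPres.card_pos) (Nat.cast_le.2 ?_)
        exact card_preserving_le_of_properPartitions_eq_empty (isPart_components _) hempty hq1 hPsi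
      have hmul := mul_le_mul_of_nonneg_left hlog (Nat.cast_nonneg (α := ℝ) (Fintype.card V))
      -- In `secondStageBound`, 1 pays for the present step, one n for the remaining requests and
      -- the other n for the first resampling.
      refine (add_le_add h1 (expectedCost_secondStage_le τ g' p rs _ hc.tail)).trans ?_
      rw [← ENNReal.ofReal_add zero_le_one (by
        have := Real.log_natCast_nonneg (preserving (components (h ++ [r]))).card
        positivity)]
      apply ENNReal.ofReal_le_ofReal
      unfold secondStageBound
      linarith
    · have hne := Finset.nonempty_iff_ne_empty.2 hempty
      obtain ⟨pc, hpc'⟩ : ∃ pc, pc = τ.select (h ++ [r]) p (closest p (components (h ++ [r]))) :=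
        ⟨_, rfl⟩
      have hpc : pc ∈ closest p (components (h ++ [r])) := by
        rw [hpc']
        apply τ.select_mem
        obtain ⟨p₁, hp₁, hmin⟩ := Finset.exists_min_image _ (fun p' => hammingDist p p') hPres
        exact ⟨p₁, Finset.mem_filter.2 ⟨hp₁, hmin⟩⟩
      obtain ⟨p', hstep, hp'⟩ : ∃ p',
          firstStageStep τ ⟨h, p, g, true⟩ (h ++ [r]) = ⟨h ++ [r], p', g', true⟩ ∧
          (pc ∈ properPartitions g' (dParam (Fintype.card V)) (components (h ++ [r])) ∧ p' = pc ∨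
            pc ∉ properPartitions g' (dParam (Fintype.card V)) (components (h ++ [r])) ∧
              p' ∈ properPartitions g' (2 * dParam (Fintype.card V)) (components (h ++ [r]))) := by
        by_cases hmem : pc ∈ properPartitions g' (dParam (Fintype.card V)) (components (h ++ [r]))
        · refine ⟨pc, ?_, Or.inl ⟨hmem, rfl⟩⟩
          simp only [firstStageStep, ← hg', hempty, if_false, ← hpc', hmem, if_true]
        · refine ⟨_, ?_, Or.inr ⟨hmem, τ.select_mem (h ++ [r]) p _ hne⟩⟩
          simp only [firstStageStep, ← hg', hempty, if_false, ← hpc', hmem]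
      have hproper : p' ∈ properPartitions g' (dParam (Fintype.card V))
          (components (h ++ [r])) := by
        rcases hp' with ⟨h1, rfl⟩ | ⟨-, h2⟩
        · exact h1
        · exact properPartitions_mono g' (by omega) _ h2
      have hA : multiplesUpTo (qParam (Fintype.card V)) g ∩ popular (components (h ++ [r])) ⊆
          Finset.Icc 1 (qParam (Fintype.card V)) :=
        Finset.inter_subset_left.trans (multiplesUpTo_subset _ _)
      -- The estimator stays finite: for ⊤ the set of relevant sizes is empty, and no cluster could
      -- contain `d ≥ 1` relevant components.
      obtain ⟨m, hm, hm1, hmq⟩ := exists_gcdTop_eq hA (by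
        rw [← hg']
        rintro rfl
        have h2 := (mem_properPartitions.1 hproper).2 true
        rw [multiplesUpTo_top] at h2
        simp only [sideComps, Finset.notMem_empty, and_false, Finset.filter_false,
          Finset.card_empty] at h2
        omega)
      have hamort : 1 + (hammingDist p p' : ℝ) + potential (components (h ++ [r])) p' g' ≤
          potential (components h) p g := by
        rw [hjoin] at hg' hpc hp' ⊢
        exact potential_step hC hx hy hxy hg hgq hd hp hg' hpc hp'
      rw [hstep]
      rw [← hg'] at hm
      subst hm
      refine (add_le_add_right (ih _ p' m hc.tail hm1 hmq hproper hPsi) _).trans ?_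
      have h1 : (stepCost ⟨h, p, g, true⟩ r ⟨h ++ [r], p', m, true⟩ : ℝ) ≤
          1 + hammingDist p p' := by
        exact_mod_cast stepCost_le ⟨h, p, g, true⟩ r ⟨h ++ [r], p', m, true⟩
      have hpot' := potential_nonneg (components (h ++ [r])) p' m
      rw [← ENNReal.ofReal_natCast, ← ENNReal.ofReal_add (Nat.cast_nonneg _) (by linarith)]
      apply ENNReal.ofReal_le_ofReal
      linarith

end FirstStage

/-! ### Sizes of the parameters in terms of a = n^(1/14) and L = √(log n). -/

section Asymptotics

theorem rpow_div_fourteen {n : ℕ} (k : ℕ) :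
    (n : ℝ) ^ ((k : ℝ) / 14) = ((n : ℝ) ^ (1 / 14 : ℝ)) ^ k := by
  rw [← Real.rpow_natCast, ← Real.rpow_mul (Nat.cast_nonneg n)]
  congr 1
  ring

/-- The parameters of the algorithm in terms of `a = n^(1/14)` and `L = √(log n)`. -/
structure ParamBounds (n : ℕ) (a L : ℝ) : Prop where
  eleven_le : 11 ≤ a
  pow_eq : a ^ 14 = n
  rpow_eq : (n : ℝ) ^ (27 / 14 : ℝ) = a ^ 27
  one_le : 1 ≤ L
  sq_eq : L ^ 2 = Real.log n
  mul_lt : 100 * L < a ^ 3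
  le_q : a ^ 2 ≤ qParam n
  q_le : (qParam n : ℝ) ≤ 2 * a ^ 2
  le_d : a ^ 13 / L ≤ dParam n
  d_le : (dParam n : ℝ) ≤ a ^ 13 / L + 1

theorem paramBounds {n : ℕ} (hn : 11 ^ 14 ≤ n) :
    ParamBounds n ((n : ℝ) ^ (1 / 14 : ℝ)) (Real.sqrt (Real.log n)) := by
  set a := (n : ℝ) ^ (1 / 14 : ℝ) with ha
  set L := Real.sqrt (Real.log n) with hL
  have hnR : (11 : ℝ) ^ 14 ≤ n := by exact_mod_cast hn
  have hn0 : (0 : ℝ) < n := lt_of_lt_of_le (by norm_num) hnR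
  have hpow : a ^ 14 = n := by
    rw [ha, ← rpow_div_fourteen]
    norm_num
  have ha0 : 0 ≤ a := by positivity
  have h11 : 11 ≤ a := by
    refine le_of_pow_le_pow_left₀ (n := 14) (by norm_num) ha0 ?_
    rw [hpow]
    exact hnR
  have hlog1 : 1 ≤ Real.log n := by
    rw [Real.le_log_iff_exp_le hn0]
    have := Real.exp_one_lt_three
    linarith
  have hsq : L ^ 2 = Real.log n := Real.sq_sqrt (by linarith)
  have hL1 : 1 ≤ L := Real.one_le_sqrt.2 hlog1
  have hlog : Real.log n ≤ 14 * a := by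
    rw [← hpow, Real.log_pow]
    have := Real.log_le_sub_one_of_pos (by linarith : 0 < a)
    push_cast
    linarith
  have h7 : (n : ℝ) ^ (1 / 7 : ℝ) = a ^ 2 := by
    rw [ha, ← rpow_div_fourteen]
    norm_num
  have h13 : (n : ℝ) ^ (13 / 14 : ℝ) = a ^ 13 := by
    rw [ha, ← rpow_div_fourteen]
    norm_num
  have hq1 : a ^ 2 ≤ qParam n := by
    rw [← h7]
    exact Nat.le_ceil _
  have hq2 : (qParam n : ℝ) < a ^ 2 + 1 := by
    rw [← h7]
    exact Nat.ceil_lt_add_one (by positivity)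
  have hd1 : a ^ 13 / L ≤ dParam n := by
    rw [← h13]
    exact Nat.le_ceil _
  have hd2 : (dParam n : ℝ) < a ^ 13 / L + 1 := by
    rw [← h13]
    exact Nat.ceil_lt_add_one (by positivity)
  refine ⟨h11, hpow, ?_, hL1, hsq, ?_, hq1, ?_, hd1, hd2.le⟩
  · rw [ha, ← rpow_div_fourteen]
    norm_num
  -- The threshold a ≥ 11 enters here: log n ≤ 14a, and 140000 < 11^5.
  · refine lt_of_pow_lt_pow_left₀ 2 (by positivity) ?_
    have h5 : (11 : ℝ) ^ 5 ≤ a ^ 5 := pow_le_pow_left₀ (by norm_num) h11 5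
    have h6 : (11 : ℝ) ^ 5 * a ≤ a ^ 5 * a := mul_le_mul_of_nonneg_right h5 ha0
    calc (100 * L) ^ 2 = 10000 * Real.log n := by rw [mul_pow, hsq]; norm_num
      _ ≤ 10000 * (14 * a) := by linarith
      _ < 11 ^ 5 * a := by norm_num; linarith
      _ ≤ a ^ 5 * a := h6
      _ = (a ^ 3) ^ 2 := by ring
  · have : 1 ≤ a ^ 2 := one_le_pow₀ (by linarith)
    linarith

variable {n : ℕ} {a L : ℝ}

theorem ParamBounds.one_le_q (h : ParamBounds n a L) : 1 ≤ qParam n := by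
  have h1 : 1 ≤ a ^ 2 := one_le_pow₀ (by linarith [h.eleven_le])
  exact_mod_cast h1.trans h.le_q

theorem ParamBounds.q_pow_le (h : ParamBounds n a L) (k : ℕ) :
    (qParam n : ℝ) ^ k ≤ 2 ^ k * a ^ (2 * k) := by
  rw [pow_mul, ← mul_pow]
  exact pow_le_pow_left₀ (Nat.cast_nonneg _) h.q_le k

/-- The pigeonhole condition of `exists_frequent_size` for `m = 3 * q ^ 4`: d components of at most
q sizes include enough of one size. -/
theorem ParamBounds.q_mul_lt_d (h : ParamBounds n a L) :
    qParam n * (3 * qParam n ^ 4 + 2) < dParam n := by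
  have ha1 : 1 ≤ a := by linarith [h.eleven_le]
  have hL : 0 < L := by linarith [h.one_le]
  have h5 := h.q_pow_le 5
  have h1 := h.q_pow_le 1
  have h10 : a ^ 2 ≤ a ^ 10 := pow_le_pow_right₀ ha1 (by norm_num)
  have hlt : 100 * a ^ 10 < a ^ 13 / L := by
    rw [lt_div_iff₀ hL]
    calc 100 * a ^ 10 * L = a ^ 10 * (100 * L) := by ring
      _ < a ^ 10 * a ^ 3 := by
        have := h.mul_lt
        gcongr
      _ = a ^ 13 := by ring
  have : (qParam n : ℝ) * (3 * (qParam n : ℝ) ^ 4 + 2) < dParam n := by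
    calc (qParam n : ℝ) * (3 * (qParam n : ℝ) ^ 4 + 2) =
          3 * (qParam n : ℝ) ^ 5 + 2 * (qParam n : ℝ) ^ 1 := by ring
      _ ≤ 100 * a ^ 10 := by norm_num at h5 h1 ⊢; linarith
      _ < _ := hlt
      _ ≤ _ := h.le_d
  exact_mod_cast this

/-- Ensures that the n/2 singletons in each initial cluster number at least d. -/
theorem ParamBounds.two_mul_d_le (h : ParamBounds n a L) : 2 * dParam n ≤ n := by
  have ha := h.eleven_le
  have h13 : 1 ≤ a ^ 13 := one_le_pow₀ (by linarith)
  have h1 : a ^ 13 / L ≤ a ^ 13 := div_le_self (by linarith) h.one_le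
  have h2 : 11 * a ^ 13 ≤ a ^ 14 := by
    calc 11 * a ^ 13 ≤ a * a ^ 13 := by gcongr
      _ = a ^ 14 := by ring
  have : 2 * (dParam n : ℝ) ≤ n := by
    rw [← h.pow_eq]
    linarith [h.d_le]
  exact_mod_cast this

/-- A bound on `sizePotential` at the beginning of an epoch. -/
noncomputable def initialSizePotential (n : ℕ) : ℕ :=
  n + (qParam n ^ 2 * wParam n + qParam n) * qParam n

/-- The choice q ≈ n^(1/7) balances n/q against q²w ≈ 4q^6; both are of order a^12. -/
theorem ParamBounds.initialSizePotential_div_le (h : ParamBounds n a L) :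
    (initialSizePotential n : ℝ) / qParam n ≤ 500 * a ^ 12 := by
  have ha1 : 1 ≤ a := by linarith [h.eleven_le]
  have hq : (0 : ℝ) < qParam n := by exact_mod_cast h.one_le_q
  rw [div_le_iff₀ hq, initialSizePotential, wParam]
  push_cast
  have h6 := h.q_pow_le 6
  have h2 := h.q_pow_le 2
  have h1 := h.q_pow_le 1
  have e1 : (n : ℝ) ≤ a ^ 12 * qParam n := by
    rw [← h.pow_eq]
    calc a ^ 14 = a ^ 12 * a ^ 2 := by ring
      _ ≤ _ := by
        have := h.le_q
        gcongr
  have e2 : a ^ 2 ≤ a ^ 12 := pow_le_pow_right₀ ha1 (by norm_num)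
  have e4 : a ^ 4 ≤ a ^ 12 := pow_le_pow_right₀ ha1 (by norm_num)
  have e3 : (qParam n : ℝ) ^ 2 * (4 * (qParam n : ℝ) ^ 4 + 2) + qParam n ≤ 499 * a ^ 12 := by
    calc _ = 4 * (qParam n : ℝ) ^ 6 + 2 * (qParam n : ℝ) ^ 2 + (qParam n : ℝ) ^ 1 := by ring
      _ ≤ _ := by norm_num at h6 h2 h1 ⊢; linarith
  have := mul_le_mul_of_nonneg_right e3 hq.le
  linarith

theorem ParamBounds.cheapCost_le (h : ParamBounds n a L) : cheapCost n ≤ 200 * (a ^ 9 * L) := by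
  have ha1 : 1 ≤ a := by linarith [h.eleven_le]
  have hL := h.one_le
  have h4 := h.q_pow_le 4
  norm_num at h4
  have hd0 : 0 < a ^ 13 / L := by positivity
  have hnd : (n : ℝ) / dParam n ≤ a * L := by
    rw [div_le_iff₀ (hd0.trans_le h.le_d), ← h.pow_eq]
    calc a ^ 14 = a * L * (a ^ 13 / L) := by field_simp
      _ ≤ _ := by
        have := h.le_d
        gcongr
  have h8 : 1 ≤ a ^ 8 := one_le_pow₀ ha1
  unfold cheapCost
  calc _ ≤ 1 + 4 * (16 * a ^ 8) + 2 * (4 * (16 * a ^ 8) + 2) * (a * L) := by gcongr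
    _ ≤ 65 * a ^ 8 + 2 * (66 * a ^ 8) * (a * L) := by
      gcongr ?_ + 2 * ?_ * (a * L) <;> linarith
    _ ≤ 65 * a ^ 8 * (a * L) + 2 * (66 * a ^ 8) * (a * L) := by
      have := le_mul_of_one_le_right (by positivity : 0 ≤ 65 * a ^ 8)
        (one_le_mul_of_one_le_of_one_le ha1 hL)
      linarith
    _ = 197 * (a ^ 9 * L) := by ring
    _ ≤ _ := by gcongr; norm_num

/-- The main contribution is 2d · log(n + 1), of order (a^13 / L) · L² = a^13 · L; the power of 2
adds only O(a^12). -/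
theorem ParamBounds.log_le (h : ParamBounds n a L) :
    Real.log ((2 * ((n + 1) ^ (2 * dParam n) * 2 ^ (initialSizePotential n / qParam n)) : ℕ) : ℝ) ≤
      600 * (a ^ 13 * L) := by
  have ha1 : 1 ≤ a := by linarith [h.eleven_le]
  have hL := h.one_le
  have hn2 : (2 : ℝ) ≤ n := by
    rw [← h.pow_eq]
    calc (2 : ℝ) ≤ a ^ 1 := by linarith [h.eleven_le]
      _ ≤ a ^ 14 := pow_le_pow_right₀ ha1 (by norm_num)
  push_cast
  rw [Real.log_mul (by norm_num) (by positivity), Real.log_mul (by positivity) (by positivity),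
    Real.log_pow, Real.log_pow]
  have hlog2 : Real.log 2 ≤ 1 := by linarith [Real.log_two_lt_d9]
  have hlogn : Real.log ((n : ℝ) + 1) ≤ 2 * L ^ 2 := by
    rw [h.sq_eq, ← Nat.cast_ofNat (R := ℝ), ← Real.log_pow]
    refine Real.log_le_log (by positivity) ?_
    nlinarith
  have hdiv : ((initialSizePotential n / qParam n : ℕ) : ℝ) ≤ 500 * a ^ 12 :=
    Nat.cast_div_le.trans h.initialSizePotential_div_le
  have hLa : L ≤ a ^ 13 := by
    have h3 : a ^ 3 ≤ a ^ 13 := pow_le_pow_right₀ ha1 (by norm_num)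
    linarith [h.mul_lt]
  have h13 : 1 ≤ a ^ 13 := one_le_pow₀ ha1
  have h12 : a ^ 12 ≤ a ^ 13 * L := by
    calc a ^ 12 ≤ a ^ 13 := pow_le_pow_right₀ ha1 (by norm_num)
      _ ≤ _ := le_mul_of_one_le_right (by positivity) hL
  have h1 : 1 ≤ a ^ 13 * L := one_le_mul_of_one_le_of_one_le h13 hL
  have hdL : (dParam n : ℝ) * L ^ 2 ≤ 2 * (a ^ 13 * L) := by
    calc (dParam n : ℝ) * L ^ 2 ≤ (a ^ 13 / L + 1) * L ^ 2 := by
          have := h.d_le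
          gcongr
      _ = a ^ 13 * L + L * L := by field_simp
      _ ≤ a ^ 13 * L + a ^ 13 * L := by gcongr
      _ = _ := by ring
  have t1 : (2 * dParam n : ℝ) * Real.log ((n : ℝ) + 1) ≤ 8 * (a ^ 13 * L) := by
    calc (2 * dParam n : ℝ) * Real.log ((n : ℝ) + 1) ≤ (2 * dParam n) * (2 * L ^ 2) := by gcongr
      _ = 4 * (dParam n * L ^ 2) := by ring
      _ ≤ _ := by linarith
  have t2 : ((initialSizePotential n / qParam n : ℕ) : ℝ) * Real.log 2 ≤ 500 * a ^ 12 * 1 := by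
    have := Real.log_nonneg (one_le_two (α := ℝ))
    gcongr
  push_cast
  linarith

/-- The summands have orders a^26, a^14, a^23 · L and a^27 · L; the second stage supplies the last
and dominates. -/
theorem ParamBounds.total_le (h : ParamBounds n a L) :
    (5 * n + 1) / qParam n * initialSizePotential n + 4 * n + cheapCost n * n +
      secondStageBound n (initialSizePotential n) ≤ 5000 * (a ^ 27 * L) := by
  have ha1 : 1 ≤ a := by linarith [h.eleven_le]
  have hL := h.one_le
  have h14 : 1 ≤ a ^ 14 := one_le_pow₀ ha1
  have t1 : (5 * n + 1) / qParam n * (initialSizePotential n : ℝ) ≤ 6 * a ^ 14 * (500 * a ^ 12) := by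
    have := h.initialSizePotential_div_le
    calc (5 * n + 1) / qParam n * (initialSizePotential n : ℝ) =
          (5 * n + 1) * (initialSizePotential n / qParam n) := by ring
      _ ≤ _ := by
        rw [← h.pow_eq]
        gcongr
        linarith
  have t2 : cheapCost n * n ≤ 200 * (a ^ 9 * L) * a ^ 14 := by
    rw [← h.pow_eq]
    have := h.cheapCost_le
    gcongr
  have t3 := mul_le_mul_of_nonneg_left h.log_le (Nat.cast_nonneg (α := ℝ) n)
  have hbig : ∀ k ≤ 27, a ^ k ≤ a ^ 27 * L := fun k hk =>
    (pow_le_pow_right₀ ha1 hk).trans (le_mul_of_one_le_right (by positivity) hL)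
  have b26 := hbig 26 (by norm_num)
  have b14 := hbig 14 (by norm_num)
  have b0 := hbig 0 (by norm_num)
  have b23 : a ^ 23 * L ≤ a ^ 27 * L := by
    gcongr
    · norm_num
  have s1 : 6 * a ^ 14 * (500 * a ^ 12) = 3000 * a ^ 26 := by ring
  have s2 : 200 * (a ^ 9 * L) * a ^ 14 = 200 * (a ^ 23 * L) := by ring
  have s3 : a ^ 14 * (600 * (a ^ 13 * L)) = 600 * (a ^ 27 * L) := by ring
  unfold secondStageBound
  rw [← h.pow_eq] at t3 t1 t2 ⊢
  rw [s3] at t3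
  rw [s1] at t1
  rw [s2] at t2
  rw [pow_zero] at b0
  linarith

end Asymptotics

/-! ### The initial state and the conclusion. -/

section InitialState

variable {V : Type*} [Fintype V] [DecidableEq V]

theorem sizePotential_initial_le (hq : 1 ≤ qParam (Fintype.card V)) :
    sizePotential (components ([] : List (V × V))) (1 : ℕ) ≤
      initialSizePotential (Fintype.card V) := by
  unfold sizePotential initialSizePotential
  refine Nat.add_le_add ?_ (Nat.mul_le_mul_left _ ?_)
  · refine le_trans (Finset.sum_le_card_nsmul _ _ 1 fun c hc => ?_) ?_
    · obtain ⟨v, -, rfl⟩ := Finset.mem_image.1 hc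
      have : 1 ∈ multiplesUpTo (qParam (Fintype.card V)) (1 : ℕ) :=
        mem_multiplesUpTo_coe.2 ⟨Finset.mem_Icc.2 ⟨le_rfl, hq⟩, dvd_rfl⟩
      simp only [sizeWeight, Finset.card_singleton, this, hq, if_true]
      norm_num
    · rw [smul_eq_mul, mul_one]
      exact (isPart_components _).card_le
  · simpa using Finset.card_le_card (multiplesUpTo_subset (qParam (Fintype.card V)) (1 : ℕ))

theorem mem_properPartitions_initial (hq : 1 ≤ qParam (Fintype.card V))
    (hd : 2 * dParam (Fintype.card V) ≤ Fintype.card V) {p : V → Bool} (hp : IsBalanced p) :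
    p ∈ properPartitions (1 : ℕ) (dParam (Fintype.card V)) (components []) := by
  refine mem_properPartitions.2 ⟨mem_preserving.2 ⟨hp, fun c hc u hu v hv => ?_⟩, fun b => ?_⟩
  · obtain ⟨w, -, rfl⟩ := Finset.mem_image.1 hc
    rw [Finset.mem_singleton] at hu hv
    rw [hu, hv]
  · have h1 : 1 ∈ multiplesUpTo (qParam (Fintype.card V)) (1 : ℕ) :=
      mem_multiplesUpTo_coe.2 ⟨Finset.mem_Icc.2 ⟨le_rfl, hq⟩, dvd_rfl⟩
    have hsub : (Finset.univ.filter fun v => p v = b).image (fun v => ({v} : Finset V)) ⊆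
        sideComps (components []) p b (multiplesUpTo (qParam (Fintype.card V)) (1 : ℕ)) := by
      intro c hc
      obtain ⟨v, hv, rfl⟩ := Finset.mem_image.1 hc
      refine Finset.mem_filter.2 ⟨Finset.mem_image_of_mem _ (Finset.mem_univ v), ?_, by simpa using h1⟩
      intro u hu
      rw [Finset.mem_singleton.1 hu]
      exact (Finset.mem_filter.1 hv).2
    have h2 := Finset.card_le_card hsub
    rw [Finset.card_image_of_injective _ Finset.singleton_injective] at h2
    have h3 := hp b
    omega

theorem potential_initial_le (hq : 1 ≤ qParam (Fintype.card V)) (hd : 1 ≤ dParam (Fintype.card V))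
    (p : V → Bool) :
    potential (components []) p (1 : ℕ) ≤
      (5 * Fintype.card V + 1) / qParam (Fintype.card V) * initialSizePotential (Fintype.card V) +
        4 * Fintype.card V + cheapCost (Fintype.card V) * Fintype.card V := by
  have hd' : (0 : ℝ) < dParam (Fintype.card V) := by exact_mod_cast hd
  have h1 : (sizePotential (components ([] : List (V × V))) (1 : ℕ) : ℝ) ≤
      initialSizePotential (Fintype.card V) := by exact_mod_cast sizePotential_initial_le hq
  have h2 : (deficit (components []) p (1 : ℕ) : ℝ) ≤ 4 * dParam (Fintype.card V) := by
    exact_mod_cast deficit_le (components []) p (1 : ℕ)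
  have h3 : ((components ([] : List (V × V))).card : ℝ) ≤ Fintype.card V := by
    exact_mod_cast (isPart_components _).card_le
  have h4 := cheapCost_nonneg (Fintype.card V)
  have h5 : (4 * Fintype.card V : ℝ) =
      Fintype.card V / dParam (Fintype.card V) * (4 * dParam (Fintype.card V)) := by field_simp
  rw [h5]
  unfold potential
  gcongr

end InitialState

end Bisection

theorem mainTheorem2 :
    ∃ (K : ℝ) (n₀ : ℕ), ∀ (V : Type*) [Fintype V] [DecidableEq V],
      n₀ ≤ Fintype.card V →
      ∀ (τ : Bisection.TieBreaking V) (p₀ : V → Bool), Bisection.IsBalanced p₀ →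
      ∀ rs : List (V × V), Bisection.IsEpoch rs →
        Bisection.icbExpectedCost τ p₀ rs ≤
          ENNReal.ofReal (K * (Fintype.card V : ℝ) ^ (27 / 14 : ℝ) *
            Real.sqrt (Real.log (Fintype.card V))) := by
  refine ⟨5000, 11 ^ 14, fun V _ _ hn τ p₀ hp₀ rs hrs => ?_⟩
  have hb := Bisection.paramBounds hn
  have hq := hb.one_le_q
  have hd := hb.q_mul_lt_d
  -- `icbExpectedCost` unfolds to `expectedCost` from the initial state, whose estimator 1 is the
  -- cast of the natural number 1.
  refine (Bisection.expectedCost_firstStage_le τ hd rs [] p₀ 1 hrs.continues le_rfl hq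
    (Bisection.mem_properPartitions_initial hq hb.two_mul_d_le hp₀)
    (Bisection.sizePotential_initial_le hq)).trans ?_
  apply ENNReal.ofReal_le_ofReal
  rw [hb.rpow_eq, mul_assoc]
  refine le_trans ?_ hb.total_le
  have := Bisection.potential_initial_le hq (by omega) p₀
  gcongr
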